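/- Let $X$ be a non-empty (finite or infinite) countable set and let $k(x,y)\ge 0$ for $x\neq y$ be the jump rates of a time-homogeneous continuous-time Markov chain $(Z_t)_{t\ge 0}$ on $X$, with $k(x,x)=-\sum_{y\ne x}k(x,y)$. Assume that for every $x\in X$ $$M_1(x)=\sum_{y\neq x}k(x,y)<\infty,\qquad M_2(x)=\sum_{y\neq x}k(x,y)\sum_{z\neq y}k(y,z)<\infty .$$ Let $P_tf(x)=\mathbb E(f(Z_t)\mid Z_0=x)$ be the associated semigroup on $\ell^\infty(X)$, the bounded real functions on $X$, and let $Lf(x)=\sum_y k(x,y)(f(y)-f(x))$ be the generator. Assume that the chain is irreducible and positive recurrent, and that $\mu$ is a probability measure on $X$ satisfying the detailed balance condition $\mu(\{x\})k(x,y)=\mu(\{y\})k(y,x)$ for all $x,y\in X$ (so $\mu$ is the unique invariant probability measure). Assume moreover that $M_1\in\ell^2(\mu)$ and $M_2\in\ell^1(\mu)$. Put $\Upsilon(r)=e^r-r-1$ and, for $f\in\ell^\infty(X)$ and $x\in X$, $$\Psi_\Upsilon(f)(x)=\sum_{y}k(x,y)\,\Upsilon(f(y)-f(x)),$$ $$\Psi_{2,\Upsilon}(f)(x)=\tfrac12\Big(L\Psi_\Upsilon(f)(x)-\sum_{y}k(x,y)\,\Upsilon'(f(y)-f(x))\,(Lf(y)-Lf(x))\Big).$$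 For $F:[0,\infty)\to[0,\infty)$ with $F(0)=0$, set $F_0(r)=F(r)$ for $r\ge0$ and $F_0(r)=0$ for $r<0$. We say that $L$ satisfies $CD_\Upsilon(\kappa,F)$ if $$\Psi_{2,\Upsilon}(f)(x)\ \ge\ \kappa\,\Psi_\Upsilon(f)(x)+F_0(-Lf(x))\qquad\text{for all }x\in X,\ f\in\ell^\infty(X),$$ and that $L$ satisfies $CD_\Upsilon(\kappa,n)$ if it satisfies $CD_\Upsilon(\kappa,F)$ with $F(r)=r^2/n$. (i) Let $\kappa>0$, $\delta\ge1$, $n\in(0,\infty)$, and let $L$ satisfy $CD_\Upsilon(\kappa,F)$ with $F(r)=r^{1+\delta}/n$. Then for every $t>0$ and every $f\in\ell^\infty(X)$ $$\|e^{P_tf}\|_\infty\ \le\ \exp\Big(\Phi\Big(\big(\tfrac{n}{2\delta t}\big)^{1/\delta}\Big)\Big)\,\|e^f\|_1,$$ where $\|\cdot\|_1$ is the norm of $\ell^1(\mu)$ and $$\Phi(r)=\frac{(\kappa n)^{1/\delta}}{2\kappa}\int_{(\kappa n)^{1/\delta}/r}^\infty\frac{v^{\delta-2}}{v^\delta+1}\,dv,\qquad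 r>0.$$ (ii) In particular, if $L$ satisfies $CD_\Upsilon(\kappa,n)$ with $\kappa>0$ and $n\in(0,\infty)$, then for every $t>0$ and every $f\in\ell^\infty(X)$ $$\|e^{P_tf}\|_\infty\ \le\ \Big(1+\frac1{2\kappa t}\Big)^{n/2}\|e^f\|_1.$$ -/

import Mathlib

open MeasureTheory Set
open scoped ENNReal

namespace MarkovChain

noncomputable section

/-- Transition rates of a continuous-time Markov chain: `k x y ≥ 0` is the rate of jumping from `x`
to `y ≠ x`, and the rows are (absolutely) summable with sum zero. -/
structure IsRateMatrix {X : Type*} (k : X → X → ℝ) : Prop where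
  nonneg : ∀ x y, x ≠ y → 0 ≤ k x y
  hasSum_zero : ∀ x, HasSum (k x) 0

/-- The total jump rate `M₁(x) = ∑_{y ≠ x} k(x,y)`. -/
def M₁ {X : Type*} (k : X → X → ℝ) (x : X) : ℝ :=
  ∑' y : {y : X // y ≠ x}, k x y

/-- Finiteness at every point of `M₂(x) = ∑_{y ≠ x} k(x,y) ∑_{z ≠ y} k(y,z)`. -/
def M₂Finite {X : Type*} (k : X → X → ℝ) : Prop :=
  ∀ x, Summable fun y : {y : X // y ≠ x} => k x y * M₁ k y

/-- The function `M₂(x) = ∑_{y ≠ x} k(x,y) ∑_{z ≠ y} k(y,z)`. -/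
def M₂ {X : Type*} (k : X → X → ℝ) (x : X) : ℝ :=
  ∑' y : {y : X // y ≠ x}, k x y * M₁ k y

/-- Irreducibility: any state can be reached from any other one by finitely many jumps of positive
rate. -/
def IsIrreducible {X : Type*} (k : X → X → ℝ) : Prop :=
  ∀ x y, Relation.ReflTransGen (fun a b => a ≠ b ∧ 0 < k a b) x y

/-- The detailed balance condition `μ({x}) k(x,y) = μ({y}) k(y,x)`. -/
def DetailedBalance {X : Type*} [MeasurableSpace X] (k : X → X → ℝ) (μ : Measure X) : Prop :=
  ∀ x y, μ.real {x} * k x y = μ.real {y} * k y x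

/-! ### The chain, through its transition probabilities -/

/-- The probability that the chain started at `x` is in the state `y` at time `t` and has made at
most `m` jumps up to time `t`. The recursion conditions on the first jump: the chain waits at `x`
for an exponential time `s` of parameter `M₁(x)` and then jumps to `z ≠ x` with probability
`k(x,z) / M₁(x)`. -/
def transProbJumps {X : Type*} (k : X → X → ℝ) : ℕ → ℝ → X → X → ℝ≥0∞
  | 0, t, x, y => indicator {x} (fun _ => ENNReal.ofReal (Real.exp (-(M₁ k x * t)))) y
  | m + 1, t, x, y =>
      indicator {x} (fun _ => ENNReal.ofReal (Real.exp (-(M₁ k x * t)))) y +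
        ∫⁻ s in Ioc 0 t, ENNReal.ofReal (Real.exp (-(M₁ k x * s))) *
          ∑' z : {z : X // z ≠ x}, ENNReal.ofReal (k x z) * transProbJumps k m (t - s) z y

/-- The transition probability `ℙ(Z_t = y | Z_0 = x)` of the (minimal) chain with rates `k`:
the increasing limit over the number of jumps, so that a path which has exploded before time `t`
does not contribute. -/
def transProb {X : Type*} (k : X → X → ℝ) (t : ℝ) (x y : X) : ℝ≥0∞ :=
  ⨆ m, transProbJumps k m t x y

/-- The (sub-)Markov semigroup `P_t f(x) = 𝔼(f(Z_t) | Z_0 = x)` on bounded functions. -/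
def semigroup {X : Type*} (k : X → X → ℝ) (t : ℝ) (f : X → ℝ) (x : X) : ℝ :=
  ∑' y, (transProb k t x y).toReal * f y

/-- The probability that the chain started at `z` enters the state `x` by one of its first `m`
jumps, and not later than at time `t`. -/
def entranceProbJumps {X : Type*} (k : X → X → ℝ) (x : X) : ℕ → ℝ → X → ℝ≥0∞
  | 0, _, _ => 0
  | m + 1, t, z =>
      ∫⁻ s in Ioc 0 t, ENNReal.ofReal (Real.exp (-(M₁ k z * s))) *
        ∑' w : {w : X // w ≠ z}, ENNReal.ofReal (k z w) *
          (indicator {x} (fun _ => 1) (w : X) +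
            indicator {x}ᶜ (fun w' => entranceProbJumps k x m (t - s) w') (w : X))

/-- The distribution function `t ↦ ℙ(T_x ≤ t | Z_0 = x)` of the first return time `T_x` to `x`
(after the first jump; `T_x = ∞` if the chain never comes back). -/
def returnProb {X : Type*} (k : X → X → ℝ) (x : X) (t : ℝ) : ℝ≥0∞ :=
  ⨆ m, entranceProbJumps k x m t x

/-- The mean return time `𝔼(T_x | Z_0 = x) = ∫₀^∞ ℙ(T_x > t | Z_0 = x) dt`. -/
def meanReturnTime {X : Type*} (k : X → X → ℝ) (x : X) : ℝ≥0∞ :=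
  ∫⁻ t in Ioi 0, (1 - returnProb k x t)

/-- Positive recurrence: every state is absorbing or has a finite mean return time. -/
def IsPositiveRecurrent {X : Type*} (k : X → X → ℝ) : Prop :=
  ∀ x, M₁ k x = 0 ∨ meanReturnTime k x < ∞

/-! ### The curvature-dimension condition -/

/-- The elements of `ℓ^∞(X)`. -/
def IsBoundedFun {X : Type*} (f : X → ℝ) : Prop :=
  ∃ C : ℝ, ∀ x, |f x| ≤ C

/-- The generator `L f(x) = ∑_y k(x,y) (f(y) - f(x))`. -/
def generator {X : Type*} (k : X → X → ℝ) (f : X → ℝ) (x : X) : ℝ :=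
  ∑' y, k x y * (f y - f x)

/-- `Ψ_H(f)(x) = ∑_y k(x,y) H(f(y) - f(x))`. -/
def Psi {X : Type*} (k : X → X → ℝ) (H : ℝ → ℝ) (f : X → ℝ) (x : X) : ℝ :=
  ∑' y, k x y * H (f y - f x)

/-- `B_H(f,g)(x) = ∑_y k(x,y) H(f(y) - f(x)) (g(y) - g(x))`. -/
def B {X : Type*} (k : X → X → ℝ) (H : ℝ → ℝ) (f g : X → ℝ) (x : X) : ℝ :=
  ∑' y, k x y * H (f y - f x) * (g y - g x)

/-- `Ψ_{2,H}(f) = (L Ψ_H(f) - B_{H'}(f, L f)) / 2`. -/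
def Psi₂ {X : Type*} (k : X → X → ℝ) (H : ℝ → ℝ) (f : X → ℝ) (x : X) : ℝ :=
  (1 / 2) * (generator k (Psi k H f) x - B k (deriv H) f (generator k f) x)

/-- `Υ(r) = e^r - r - 1`. -/
def Upsilon (r : ℝ) : ℝ := Real.exp r - r - 1

/-- The trivial extension `F₀` of a function `F` on `[0,∞)`; only the values of `F` on `[0,∞)`
matter. -/
def trivialExtension (F : ℝ → ℝ) (r : ℝ) : ℝ :=
  indicator (Ici 0) F r

/-- The condition `CD_Υ(κ,F)`. -/
def CDUpsilon {X : Type*} (k : X → X → ℝ) (κ : ℝ) (F : ℝ → ℝ) : Prop :=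
  ∀ x : X, ∀ f : X → ℝ, IsBoundedFun f →
    κ * Psi k Upsilon f x + trivialExtension F (-generator k f x) ≤ Psi₂ k Upsilon f x

/-- The condition `CD_Υ(κ,n)`, that is `CD_Υ(κ,F)` with `F(r) = r² / n`. -/
def CDUpsilonDim {X : Type*} (k : X → X → ℝ) (κ n : ℝ) : Prop :=
  CDUpsilon k κ fun r => r ^ 2 / n

/-- The growth function
`Φ(r) = (κn)^{1/δ} / (2κ) ∫_{(κn)^{1/δ}/r}^∞ v^{δ-2} / (v^δ + 1) dv`, `r > 0`. -/
def growthFun (κ δ n r : ℝ) : ℝ :=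
  (κ * n) ^ (1 / δ) / (2 * κ) *
    ∫ v in Ioi ((κ * n) ^ (1 / δ) / r), v ^ (δ - 2) / (v ^ δ + 1)

end

end MarkovChain

/-! The proof is an entropy argument combined with duality. Let `u t` be the heat flow from a
density with values in `[a, M]`, `a > 0`, and write E for its relative entropy and I for its Fisher
information. Then E' = -I. Since Υ'(log u(y) - log u(x)) = u(y)/u(x) - 1, reversibility also gives
I' = -2 ∑ m u Ψ₂(log u) (`hasSum_mul_psi₂`). Against the probability weights m u, both Ψ_Υ(log u)
and -L log u have mean I. The curvature condition and Jensen's inequality therefore yield I' ≤ -2(κ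
I + I^{1+δ}/n) (`fisherInfoDeriv_le`).

This inequality is used twice. Without its κ term it bounds I(t) by (n/(2δt))^{1/δ}, whatever the
initial density (`le_of_deriv_le_neg_rpow`). In full, it says that G(I) decreases at least as fast
as E, where G(r) = ∫₀^r dy/(2(κ + y^δ/n)). As I tends to 0, irreducibility forces u → 1 and hence E
→ 0. Integrating from t to infinity gives E(t) ≤ G(I(t)), so E(t) ≤ G((n/(2δt))^{1/δ})
(`relEntropy_le`). The substitution v = (κn)^{1/δ}/y identifies G with Φ.

The entropy bound becomes a pointwise bound by duality. The Gibbs inequality gives ∑ m f u ≤ E(u) +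
log ∑ m e^f. With u = P_t g, symmetry turns the left side into ∑ m g P_t f, and letting g approach
the density of the point mass at x bounds P_t f(x) (`semigroup_le`).

The semigroup comes from the minimal chain, so it must also be shown to solve the backward equation
(`isHeatFlow_semigroup`) and to preserve constants (`semigroup_one`). -/

namespace MarkovChain

/-! ### Weighted sums over edges and integration by parts -/

noncomputable section

/-- The total rate `∑_y K(x,y)` of a matrix of nonnegative rates. -/
def rate {X : Type*} (K : X → X → ℝ) (x : X) : ℝ := ∑' y, K x y

/-- Nonnegative rates which are reversible with respect to a strictly positive probability vector
`m`, with a total rate in `ℓ²(m)`. -/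
structure IsReversible {X : Type*} (K : X → X → ℝ) (m : X → ℝ) : Prop where
  nonneg : ∀ x y, 0 ≤ K x y
  summable : ∀ x, Summable (K x)
  pos : ∀ x, 0 < m x
  hasSum_one : HasSum m 1
  symm : ∀ x y, m x * K x y = m y * K y x
  summable_sq : Summable fun x => m x * rate K x ^ 2

/-- Functions of at most the growth of the total rate. -/
def HasRateGrowth {X : Type*} (K : X → X → ℝ) (g : X → ℝ) : Prop :=
  ∃ C, 0 ≤ C ∧ ∀ x, |g x| ≤ C * (1 + rate K x)

/-- Functions of the edges of at most the growth of the total rates at both ends. -/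
def HasEdgeGrowth {X : Type*} (K : X → X → ℝ) (A : X → X → ℝ) : Prop :=
  ∃ C, 0 ≤ C ∧ ∀ x y, |A x y| ≤ C * (1 + rate K x + rate K y)

/-- The sum of a function over the edges, with the weights `m(x) K(x,y)`. -/
def edgeSum {X : Type*} (K : X → X → ℝ) (m : X → ℝ) (A : X → X → ℝ) : ℝ :=
  ∑' p : X × X, m p.1 * K p.1 p.2 * A p.1 p.2

variable {X : Type*} {K : X → X → ℝ} {m : X → ℝ}

theorem IsBoundedFun.exists_nonneg {f : X → ℝ} (hf : IsBoundedFun f) :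
    ∃ C, 0 ≤ C ∧ ∀ x, |f x| ≤ C := by
  obtain ⟨C, hC⟩ := hf
  exact ⟨max C 0, le_max_right _ _, fun x => (hC x).trans (le_max_left _ _)⟩

namespace IsReversible

theorem rate_nonneg (h : IsReversible K m) (x : X) : 0 ≤ rate K x :=
  tsum_nonneg (h.nonneg x)

theorem summable_rate (h : IsReversible K m) : Summable fun x => m x * rate K x := by
  refine Summable.of_nonneg_of_le (fun x => mul_nonneg (h.pos x).le (h.rate_nonneg x)) (fun x => ?_)
    (h.hasSum_one.summable.add h.summable_sq)
  have := h.pos x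
  nlinarith [sq_nonneg (rate K x - 1), h.rate_nonneg x,
    mul_nonneg (h.pos x).le (sq_nonneg (rate K x - 1)), mul_nonneg (h.pos x).le (h.rate_nonneg x)]

theorem summable_edge_left (h : IsReversible K m) {c : X → ℝ} (hc : ∀ x, 0 ≤ c x)
    (hs : Summable fun x => m x * (rate K x * c x)) :
    Summable fun p : X × X => m p.1 * K p.1 p.2 * c p.1 := by
  refine (summable_prod_of_nonneg fun p =>
    mul_nonneg (mul_nonneg (h.pos _).le (h.nonneg _ _)) (hc _)).2 ⟨fun x => ?_, ?_⟩
  · exact ((h.summable x).mul_left (m x)).mul_right (c x)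
  · refine hs.congr fun x => ?_
    change _ = ∑' y, m x * K x y * c x
    rw [tsum_mul_right, tsum_mul_left, rate]
    ring

theorem summable_edge_right (h : IsReversible K m) {c : X → ℝ} (hc : ∀ x, 0 ≤ c x)
    (hs : Summable fun x => m x * (rate K x * c x)) :
    Summable fun p : X × X => m p.1 * K p.1 p.2 * c p.2 := by
  refine ((Equiv.prodComm X X).summable_iff.1 ((h.summable_edge_left hc hs).congr fun p => ?_))
  simp [h.symm p.1 p.2]

/-- The assumption that the rate is in ℓ²(m) is what makes this work: summing m(x) K(x,y) rate(x)
over y gives m(x) rate(x)², and symmetry carries this over to rate(y). The class is large enough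
because L maps bounded functions to functions of rate growth. -/
theorem summable_edge_growth (h : IsReversible K m) :
    Summable fun p : X × X => m p.1 * K p.1 p.2 * (1 + rate K p.1 + rate K p.2) := by
  have hq : Summable fun x => m x * (rate K x * rate K x) :=
    h.summable_sq.congr fun x => by ring
  have h1 : Summable fun x => m x * (rate K x * 1) := h.summable_rate.congr fun x => by ring
  refine (((h.summable_edge_left (c := fun _ => 1) (fun _ => zero_le_one) h1).add
    (h.summable_edge_left h.rate_nonneg hq)).add
    (h.summable_edge_right h.rate_nonneg hq)).congr fun p => by ring

theorem summable_edge (h : IsReversible K m) {A : X → X → ℝ} (hA : HasEdgeGrowth K A) :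
    Summable fun p : X × X => m p.1 * K p.1 p.2 * A p.1 p.2 := by
  obtain ⟨C, -, hC⟩ := hA
  refine Summable.of_norm_bounded (h.summable_edge_growth.mul_left C) fun p => ?_
  have := mul_nonneg (h.pos p.1).le (h.nonneg p.1 p.2)
  rw [norm_mul, Real.norm_of_nonneg this, Real.norm_eq_abs]
  nlinarith [mul_le_mul_of_nonneg_left (hC p.1 p.2) this]

theorem summable_row (h : IsReversible K m) {A : X → X → ℝ} (hA : HasEdgeGrowth K A) (x : X) :
    Summable fun y => K x y * A x y := by
  refine (((h.summable_edge hA).prod_factor x).mul_left (m x)⁻¹).congr fun y => ?_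
  have := (h.pos x).ne'
  field_simp

theorem summable_mul_row (h : IsReversible K m) {A : X → X → ℝ} (hA : HasEdgeGrowth K A) :
    Summable fun x => m x * ∑' y, K x y * A x y := by
  refine (h.summable_edge hA).prod.congr fun x => ?_
  rw [← tsum_mul_left]
  exact tsum_congr fun y => by ring

theorem edgeSum_eq (h : IsReversible K m) {A : X → X → ℝ} (hA : HasEdgeGrowth K A) :
    edgeSum K m A = ∑' x, m x * ∑' y, K x y * A x y := by
  rw [edgeSum, (h.summable_edge hA).tsum_prod]
  refine tsum_congr fun x => ?_
  rw [← tsum_mul_left]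
  exact tsum_congr fun y => by ring

theorem hasSum_edge (h : IsReversible K m) {A : X → X → ℝ} (hA : HasEdgeGrowth K A) :
    HasSum (fun x => m x * ∑' y, K x y * A x y) (edgeSum K m A) := by
  rw [h.edgeSum_eq hA]
  exact (h.summable_mul_row hA).hasSum

theorem edgeSum_swap (h : IsReversible K m) (A : X → X → ℝ) :
    edgeSum K m (fun x y => A y x) = edgeSum K m A := by
  rw [edgeSum, edgeSum, ← (Equiv.prodComm X X).tsum_eq]
  refine tsum_congr fun p => ?_
  simp [h.symm p.1 p.2]

theorem edgeSum_add (h : IsReversible K m) {A A' : X → X → ℝ} (hA : HasEdgeGrowth K A)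
    (hA' : HasEdgeGrowth K A') :
    edgeSum K m (fun x y => A x y + A' x y) = edgeSum K m A + edgeSum K m A' := by
  rw [edgeSum, edgeSum, edgeSum, ← (h.summable_edge hA).tsum_add (h.summable_edge hA')]
  exact tsum_congr fun p => by ring

theorem edgeSum_sub (h : IsReversible K m) {A A' : X → X → ℝ} (hA : HasEdgeGrowth K A)
    (hA' : HasEdgeGrowth K A') :
    edgeSum K m (fun x y => A x y - A' x y) = edgeSum K m A - edgeSum K m A' := by
  rw [edgeSum, edgeSum, edgeSum, ← (h.summable_edge hA).tsum_sub (h.summable_edge hA')]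
  exact tsum_congr fun p => by ring

theorem edgeSum_neg (A : X → X → ℝ) :
    edgeSum K m (fun x y => -A x y) = -edgeSum K m A := by
  rw [edgeSum, edgeSum, ← tsum_neg]
  exact tsum_congr fun p => by ring

theorem hasRateGrowth_of_bounded (h : IsReversible K m) {f : X → ℝ} (hf : IsBoundedFun f) :
    HasRateGrowth K f := by
  obtain ⟨C, h0, hC⟩ := hf.exists_nonneg
  exact ⟨C, h0, fun x => (hC x).trans (by nlinarith [mul_nonneg h0 (h.rate_nonneg x)])⟩

theorem hasEdgeGrowth_left (h : IsReversible K m) {g : X → ℝ} (hg : HasRateGrowth K g) :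
    HasEdgeGrowth K fun x _ => g x := by
  obtain ⟨C, h0, hC⟩ := hg
  exact ⟨C, h0, fun x y => (hC x).trans (by nlinarith [mul_nonneg h0 (h.rate_nonneg y)])⟩

theorem hasEdgeGrowth_right (h : IsReversible K m) {g : X → ℝ} (hg : HasRateGrowth K g) :
    HasEdgeGrowth K fun _ y => g y := by
  obtain ⟨C, h0, hC⟩ := hg
  exact ⟨C, h0, fun x y => (hC y).trans (by nlinarith [mul_nonneg h0 (h.rate_nonneg x)])⟩

end IsReversible

theorem HasEdgeGrowth.add {A A' : X → X → ℝ} (hA : HasEdgeGrowth K A) (hA' : HasEdgeGrowth K A') :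
    HasEdgeGrowth K fun x y => A x y + A' x y := by
  obtain ⟨C, h0, hC⟩ := hA
  obtain ⟨C', h0', hC'⟩ := hA'
  refine ⟨C + C', by positivity, fun x y => (abs_add_le _ _).trans ?_⟩
  linarith [hC x y, hC' x y]

theorem HasEdgeGrowth.neg {A : X → X → ℝ} (hA : HasEdgeGrowth K A) :
    HasEdgeGrowth K fun x y => -A x y := by
  obtain ⟨C, h0, hC⟩ := hA
  exact ⟨C, h0, fun x y => by simpa using hC x y⟩

theorem HasEdgeGrowth.sub {A A' : X → X → ℝ} (hA : HasEdgeGrowth K A) (hA' : HasEdgeGrowth K A') :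
    HasEdgeGrowth K fun x y => A x y - A' x y := by
  simpa only [sub_eq_add_neg] using hA.add hA'.neg

theorem HasEdgeGrowth.bounded_mul {A b : X → X → ℝ} (hA : HasEdgeGrowth K A)
    (hb : ∃ C, 0 ≤ C ∧ ∀ x y, |b x y| ≤ C) : HasEdgeGrowth K fun x y => b x y * A x y := by
  obtain ⟨C, h0, hC⟩ := hA
  obtain ⟨D, h0', hD⟩ := hb
  refine ⟨D * C, by positivity, fun x y => ?_⟩
  rw [abs_mul, mul_assoc]
  exact mul_le_mul (hD x y) (hC x y) (abs_nonneg _) h0'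

namespace IsReversible

theorem hasEdgeGrowth_diff (h : IsReversible K m) {g : X → ℝ} (hg : HasRateGrowth K g) :
    HasEdgeGrowth K fun x y => g y - g x :=
  (h.hasEdgeGrowth_right hg).sub (h.hasEdgeGrowth_left hg)

theorem hasEdgeGrowth_mul_diff (h : IsReversible K m) {u g : X → ℝ} (hu : IsBoundedFun u)
    (hg : HasRateGrowth K g) : HasEdgeGrowth K fun x y => u x * (g y - g x) := by
  obtain ⟨C, h0, hC⟩ := hu.exists_nonneg
  exact (h.hasEdgeGrowth_diff hg).bounded_mul (b := fun x _ => u x) ⟨C, h0, fun x _ => hC x⟩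

theorem bounded_diff {u : X → ℝ} (hu : IsBoundedFun u) :
    ∃ C, 0 ≤ C ∧ ∀ x y, |u y - u x| ≤ C := by
  obtain ⟨C, h0, hC⟩ := hu.exists_nonneg
  exact ⟨2 * C, by positivity, fun x y => (abs_sub _ _).trans (by linarith [hC x, hC y])⟩

theorem hasEdgeGrowth_mul_diff' (h : IsReversible K m) {u g : X → ℝ} (hu : IsBoundedFun u)
    (hg : HasRateGrowth K g) : HasEdgeGrowth K fun x y => g x * (u y - u x) := by
  simpa only [mul_comm] using
    (h.hasEdgeGrowth_left hg).bounded_mul (b := fun x y => u y - u x) (bounded_diff hu)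

/-- Invariance of m: reversibility makes the edge weight symmetric, so antisymmetric edge functions
cancel. -/
theorem edgeSum_diff (h : IsReversible K m) {g : X → ℝ} (hg : HasRateGrowth K g) :
    edgeSum K m (fun x y => g y - g x) = 0 := by
  rw [h.edgeSum_sub (h.hasEdgeGrowth_right hg) (h.hasEdgeGrowth_left hg),
    h.edgeSum_swap fun x _ => g x, sub_self]

/-- Integration by parts. -/
theorem edgeSum_mul_diff (h : IsReversible K m) {u g : X → ℝ} (hu : IsBoundedFun u)
    (hg : HasRateGrowth K g) :
    edgeSum K m (fun x y => u x * (g y - g x)) = edgeSum K m (fun x y => g x * (u y - u x)) := by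
  obtain ⟨C, h0, hC⟩ := hu.exists_nonneg
  have h1 : HasEdgeGrowth K fun x y => u y * g x :=
    (h.hasEdgeGrowth_left hg).bounded_mul (b := fun _ y => u y) ⟨C, h0, fun _ y => hC y⟩
  have h2 : HasEdgeGrowth K fun x y => u x * g y :=
    (h.hasEdgeGrowth_right hg).bounded_mul (b := fun x _ => u x) ⟨C, h0, fun x _ => hC x⟩
  have h3 : HasEdgeGrowth K fun x y => u x * g x :=
    (h.hasEdgeGrowth_left hg).bounded_mul (b := fun x _ => u x) ⟨C, h0, fun x _ => hC x⟩
  have e1 := h.edgeSum_sub h2 h3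
  have e2 := h.edgeSum_sub h1 h3
  have e3 := h.edgeSum_swap fun x y => u x * g y
  calc _ = edgeSum K m (fun x y => u x * g y - u x * g x) := by congr 1; ext x y; ring
    _ = edgeSum K m (fun x y => u y * g x - u x * g x) := by linarith
    _ = _ := by congr 1; ext x y; ring

theorem generator_abs_le (h : IsReversible K m) {f : X → ℝ} {C : ℝ} (hf : ∀ x, |f x| ≤ C) (x : X) :
    |generator K f x| ≤ 2 * C * rate K x := by
  have hs : Summable fun y => 2 * C * K x y := (h.summable x).mul_left _
  rw [rate, ← tsum_mul_left, ← Real.norm_eq_abs]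
  refine tsum_of_norm_bounded hs.hasSum fun y => ?_
  rw [norm_mul, Real.norm_of_nonneg (h.nonneg x y), Real.norm_eq_abs, mul_comm]
  refine mul_le_mul_of_nonneg_right ?_ (h.nonneg x y)
  exact (abs_sub _ _).trans (by linarith [hf x, hf y])

theorem generator_growth (h : IsReversible K m) {f : X → ℝ} (hf : IsBoundedFun f) :
    HasRateGrowth K (generator K f) := by
  obtain ⟨C, h0, hC⟩ := hf.exists_nonneg
  exact ⟨2 * C, by positivity, fun x => (h.generator_abs_le hC x).trans
    (mul_le_mul_of_nonneg_left (by linarith) (by positivity))⟩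

theorem sum_mul_generator (h : IsReversible K m) {c g : X → ℝ}
    (hA : HasEdgeGrowth K fun x y => c x * (g y - g x)) :
    HasSum (fun x => m x * (c x * generator K g x)) (edgeSum K m fun x y => c x * (g y - g x)) := by
  convert h.hasSum_edge hA using 1
  ext x
  rw [generator, ← tsum_mul_left]
  exact congrArg _ (tsum_congr fun y => by ring)

end IsReversible

end

/-! ### Fisher information and its derivative through Ψ₂ -/

noncomputable section

variable {X : Type*} {K : X → X → ℝ} {m : X → ℝ}

theorem upsilon_nonneg (r : ℝ) : 0 ≤ Upsilon r := by
  unfold Upsilon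
  linarith [Real.add_one_le_exp r]

/-- The difference of the two sides is 2(e^{r/2} - 1 - r/2). The bound later turns small Fisher
information into ratios u(y)/u(x) close to 1. -/
theorem sq_le_upsilon (r : ℝ) : (Real.exp (r / 2) - 1) ^ 2 ≤ Upsilon r := by
  have h : Real.exp r = Real.exp (r / 2) * Real.exp (r / 2) := by
    rw [← Real.exp_add]; ring_nf
  unfold Upsilon
  nlinarith [Real.add_one_le_exp (r / 2)]

theorem upsilon_abs_le {r C : ℝ} (h : |r| ≤ C) : |Upsilon r| ≤ Real.exp C + C := by
  rw [abs_of_nonneg (upsilon_nonneg r), Upsilon]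
  have h1 := abs_le.1 h
  linarith [Real.exp_le_exp.2 h1.2]

theorem deriv_upsilon : deriv Upsilon = fun r => Real.exp r - 1 := by
  funext r
  exact (((Real.hasDerivAt_exp r).sub (hasDerivAt_id r)).sub_const 1).deriv

/-- The (modified) Fisher information `-∑_x m(x) u(x) (L log u)(x)`. -/
def fisherInfo (K : X → X → ℝ) (m : X → ℝ) (u : X → ℝ) : ℝ :=
  edgeSum K m fun x y => u x * (Real.log (u x) - Real.log (u y))

/-- The relative entropy `∑_x m(x) u(x) log u(x)`. -/
def relEntropy (m : X → ℝ) (u : X → ℝ) : ℝ :=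
  ∑' x, m x * (u x * Real.log (u x))

/-- The time derivative of the Fisher information along the heat flow. -/
def fisherInfoDeriv (K : X → X → ℝ) (m : X → ℝ) (u : X → ℝ) : ℝ :=
  edgeSum K m fun x y => generator K u x * (Real.log (u x) - Real.log (u y)) +
    u x * (generator K u x / u x - generator K u y / u y)

theorem abs_log_le {a r M : ℝ} (ha : 0 < a) (h1 : a ≤ r) (h2 : r ≤ M) :
    |Real.log r| ≤ |Real.log a| + |Real.log M| := by
  have hr : 0 < r := ha.trans_le h1
  have e1 := Real.log_le_log ha h1
  have e2 := Real.log_le_log hr h2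
  rw [abs_le]
  constructor
  · linarith [neg_abs_le (Real.log a), abs_nonneg (Real.log M)]
  · linarith [le_abs_self (Real.log M), abs_nonneg (Real.log a)]

theorem isBoundedFun_of_mem {u : X → ℝ} {a M : ℝ} (ha : 0 < a) (hu : ∀ x, u x ∈ Icc a M) :
    IsBoundedFun u :=
  ⟨M, fun x => by rw [abs_of_pos (ha.trans_le (hu x).1)]; exact (hu x).2⟩

theorem isBoundedFun_log {u : X → ℝ} {a M : ℝ} (ha : 0 < a) (hu : ∀ x, u x ∈ Icc a M) :
    IsBoundedFun fun x => Real.log (u x) :=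
  ⟨_, fun x => abs_log_le ha (hu x).1 (hu x).2⟩

namespace IsReversible

theorem hasEdgeGrowth_bounded (h : IsReversible K m) {b : X → X → ℝ}
    (hb : ∃ C, 0 ≤ C ∧ ∀ x y, |b x y| ≤ C) : HasEdgeGrowth K b := by
  obtain ⟨C, h0, hC⟩ := hb
  exact ⟨C, h0, fun x y => (hC x y).trans
    (by nlinarith [mul_nonneg h0 (h.rate_nonneg x), mul_nonneg h0 (h.rate_nonneg y)])⟩

theorem bounded_upsilon {v : X → ℝ} (hv : IsBoundedFun v) :
    ∃ C, 0 ≤ C ∧ ∀ x y, |Upsilon (v y - v x)| ≤ C := by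
  obtain ⟨C, h0, hC⟩ := bounded_diff hv
  exact ⟨Real.exp C + C, by positivity, fun x y => upsilon_abs_le (hC x y)⟩

theorem psi_growth (h : IsReversible K m) {v : X → ℝ} (hv : IsBoundedFun v) :
    HasRateGrowth K (Psi K Upsilon v) := by
  obtain ⟨C, h0, hC⟩ := bounded_upsilon hv
  refine ⟨C, h0, fun x => ?_⟩
  have hs : Summable fun y => C * K x y := (h.summable x).mul_left _
  have : |Psi K Upsilon v x| ≤ C * rate K x := by
    rw [rate, ← tsum_mul_left, ← Real.norm_eq_abs]
    refine tsum_of_norm_bounded hs.hasSum fun y => ?_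
    rw [norm_mul, Real.norm_of_nonneg (h.nonneg x y), Real.norm_eq_abs, mul_comm]
    exact mul_le_mul_of_nonneg_right (hC x y) (h.nonneg x y)
  linarith

variable {u : X → ℝ} {a M : ℝ}

/-- The discrete substitute for the chain rule for the logarithm; it holds edge by edge since
exp(log u(y) - log u(x)) = u(y)/u(x). -/
theorem mul_psi_log (h : IsReversible K m) (ha : 0 < a) (hu : ∀ x, u x ∈ Icc a M) (x : X) :
    u x * Psi K Upsilon (fun x => Real.log (u x)) x =
      generator K u x - u x * generator K (fun x => Real.log (u x)) x := by
  have hb := h.hasRateGrowth_of_bounded (isBoundedFun_of_mem ha hu)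
  have hl := h.hasRateGrowth_of_bounded (isBoundedFun_log ha hu)
  rw [Psi, generator, generator, ← tsum_mul_left, ← tsum_mul_left,
    ← (h.summable_row (h.hasEdgeGrowth_diff hb) x).tsum_sub
      ((h.summable_row (h.hasEdgeGrowth_diff hl) x).mul_left _)]
  refine tsum_congr fun y => ?_
  have hx : 0 < u x := ha.trans_le (hu x).1
  have hy : 0 < u y := ha.trans_le (hu y).1
  rw [Upsilon, Real.exp_sub, Real.exp_log hx, Real.exp_log hy]
  field_simp
  ring

theorem fisherInfo_eq (h : IsReversible K m) (ha : 0 < a) (hu : ∀ x, u x ∈ Icc a M) :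
    fisherInfo K m u = edgeSum K m fun x y => u x * Upsilon (Real.log (u y) - Real.log (u x)) := by
  have hb := isBoundedFun_of_mem ha hu
  have hl := isBoundedFun_log ha hu
  have e0 := h.edgeSum_diff (h.hasRateGrowth_of_bounded hb)
  have e1 := h.edgeSum_sub (h.hasEdgeGrowth_diff (h.hasRateGrowth_of_bounded hb))
    (h.hasEdgeGrowth_mul_diff hb (h.hasRateGrowth_of_bounded hl))
  have e2 := edgeSum_neg (K := K) (m := m)
    fun x y => u x * (Real.log (u y) - Real.log (u x))
  calc fisherInfo K m u
      = edgeSum K m (fun x y => -(u x * (Real.log (u y) - Real.log (u x)))) := by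
        unfold fisherInfo; congr 1; ext x y; ring
    _ = edgeSum K m (fun x y => (u y - u x) - u x * (Real.log (u y) - Real.log (u x))) := by
        linarith
    _ = _ := by
        congr 1; ext x y
        have hx : 0 < u x := ha.trans_le (hu x).1
        have hy : 0 < u y := ha.trans_le (hu y).1
        rw [Upsilon, Real.exp_sub, Real.exp_log hx, Real.exp_log hy]
        field_simp
        ring

theorem hasSum_mul_psi (h : IsReversible K m) (ha : 0 < a) (hu : ∀ x, u x ∈ Icc a M) :
    HasSum (fun x => m x * (u x * Psi K Upsilon (fun x => Real.log (u x)) x))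
      (fisherInfo K m u) := by
  obtain ⟨C, h0, hC⟩ := (isBoundedFun_of_mem ha hu).exists_nonneg
  rw [h.fisherInfo_eq ha hu]
  convert h.hasSum_edge ((h.hasEdgeGrowth_bounded (bounded_upsilon
    (isBoundedFun_log ha hu))).bounded_mul (b := fun x _ => u x) ⟨C, h0, fun x _ => hC x⟩) using 1
  ext x
  rw [Psi, ← tsum_mul_left]
  exact congrArg _ (tsum_congr fun y => by ring)

/-- Companion of `hasSum_mul_psi`: one representation of the Fisher information serves the κ Ψ_Υ
term of the curvature condition, this one serves the F₀(-L log u) term. -/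
theorem hasSum_mul_generator_log (h : IsReversible K m) (ha : 0 < a) (hu : ∀ x, u x ∈ Icc a M) :
    HasSum (fun x => m x * (u x * -generator K (fun x => Real.log (u x)) x))
      (fisherInfo K m u) := by
  have := (h.sum_mul_generator (h.hasEdgeGrowth_mul_diff (isBoundedFun_of_mem ha hu)
    (h.hasRateGrowth_of_bounded (isBoundedFun_log ha hu)))).neg
  rw [← edgeSum_neg] at this
  have e : fisherInfo K m u =
      edgeSum K m (fun x y => -(u x * (Real.log (u y) - Real.log (u x)))) := by
    unfold fisherInfo; congr 1; ext x y; ring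
  rw [e]
  exact (funext fun x => by ring :
    (fun x => m x * (u x * -generator K (fun x => Real.log (u x)) x)) =
      fun x => -(m x * (u x * generator K (fun x => Real.log (u x)) x))) ▸ this

theorem fisherInfo_nonneg (h : IsReversible K m) (ha : 0 < a) (hu : ∀ x, u x ∈ Icc a M) :
    0 ≤ fisherInfo K m u := by
  rw [h.fisherInfo_eq ha hu]
  exact tsum_nonneg fun p => mul_nonneg (mul_nonneg (h.pos _).le (h.nonneg _ _))
    (mul_nonneg (ha.le.trans (hu _).1) (upsilon_nonneg _))

theorem edge_le_fisherInfo (h : IsReversible K m) (ha : 0 < a) (hu : ∀ x, u x ∈ Icc a M) (x y : X) :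
    m x * K x y * (u x * Upsilon (Real.log (u y) - Real.log (u x))) ≤ fisherInfo K m u := by
  obtain ⟨C, h0, hC⟩ := (isBoundedFun_of_mem ha hu).exists_nonneg
  rw [h.fisherInfo_eq ha hu]
  exact (h.summable_edge ((h.hasEdgeGrowth_bounded (bounded_upsilon
    (isBoundedFun_log ha hu))).bounded_mul (b := fun x _ => u x)
      ⟨C, h0, fun x _ => hC x⟩)).le_tsum (x, y)
    fun p _ => mul_nonneg (mul_nonneg (h.pos _).le (h.nonneg _ _))
      (mul_nonneg (ha.le.trans (hu _).1) (upsilon_nonneg _))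

/-- Multiplying by u(x) turns Υ'(log u(y) - log u(x)) into the plain difference u(y) - u(x), which
makes the term accessible to integration by parts. -/
theorem mul_psi₂_log (h : IsReversible K m) (ha : 0 < a) (hu : ∀ x, u x ∈ Icc a M) (x : X) :
    ∑' y, K x y * (u x * (Psi K Upsilon (fun x => Real.log (u x)) y -
        Psi K Upsilon (fun x => Real.log (u x)) x) -
      (u y - u x) * (generator K (fun x => Real.log (u x)) y -
        generator K (fun x => Real.log (u x)) x)) =
      u x * (2 * Psi₂ K Upsilon (fun x => Real.log (u x)) x) := by
  have hb := isBoundedFun_of_mem ha hu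
  have hl := isBoundedFun_log ha hu
  have s1 := h.summable_row (h.hasEdgeGrowth_mul_diff hb (h.psi_growth hl)) x
  have s2 := h.summable_row ((h.hasEdgeGrowth_diff (h.generator_growth hl)).bounded_mul
    (bounded_diff hb)) x
  have e : Psi₂ K Upsilon (fun x => Real.log (u x)) x = (1 / 2) *
      ((∑' y, K x y * (Psi K Upsilon (fun x => Real.log (u x)) y -
        Psi K Upsilon (fun x => Real.log (u x)) x)) -
      ∑' y, K x y * (Real.exp (Real.log (u y) - Real.log (u x)) - 1) *
        (generator K (fun x => Real.log (u x)) y -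
        generator K (fun x => Real.log (u x)) x)) := by
    rw [Psi₂, deriv_upsilon]
    rfl
  have hx : 0 < u x := ha.trans_le (hu x).1
  calc _ = ∑' y, (K x y * (u x * (Psi K Upsilon (fun x => Real.log (u x)) y -
        Psi K Upsilon (fun x => Real.log (u x)) x)) -
      K x y * ((u y - u x) * (generator K (fun x => Real.log (u x)) y -
        generator K (fun x => Real.log (u x)) x))) := tsum_congr fun y => mul_sub _ _ _
    _ = u x * ∑' y, K x y * (Psi K Upsilon (fun x => Real.log (u x)) y -
        Psi K Upsilon (fun x => Real.log (u x)) x) -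
        u x * ∑' y, K x y * (Real.exp (Real.log (u y) - Real.log (u x)) - 1) *
        (generator K (fun x => Real.log (u x)) y -
        generator K (fun x => Real.log (u x)) x) := by
        rw [s1.tsum_sub s2, ← tsum_mul_left, ← tsum_mul_left]
        congr 1
        · exact tsum_congr fun y => by ring
        · refine tsum_congr fun y => ?_
          have hy : 0 < u y := ha.trans_le (hu y).1
          rw [Real.exp_sub, Real.exp_log hx, Real.exp_log hy]
          field_simp
    _ = _ := by rw [e]; ring

theorem generator_div (h : IsReversible K m) (ha : 0 < a) (hu : ∀ x, u x ∈ Icc a M) (x : X) :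
    generator K u x / u x = generator K (fun x => Real.log (u x)) x +
      Psi K Upsilon (fun x => Real.log (u x)) x := by
  have hx : 0 < u x := ha.trans_le (hu x).1
  rw [div_eq_iff hx.ne']
  linarith [h.mul_psi_log ha hu x]

/-- The derivative of the Fisher information is `-2 ∑_x m(x) u(x) Ψ₂(log u)(x)`. -/
theorem hasSum_mul_psi₂ (h : IsReversible K m) (ha : 0 < a) (hu : ∀ x, u x ∈ Icc a M) :
    HasSum (fun x => m x * (u x * (2 * Psi₂ K Upsilon (fun x => Real.log (u x)) x)))
      (-fisherInfoDeriv K m u) := by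
  have hb := isBoundedFun_of_mem ha hu
  have hl := isBoundedFun_log ha hu
  have hbu := h.generator_growth hb
  set v : X → ℝ := fun x => Real.log (u x) with hv
  set g := generator K v with hg
  set P := Psi K Upsilon v with hP
  have gg : HasRateGrowth K g := h.generator_growth hl
  have gP : HasRateGrowth K P := h.psi_growth hl
  have a1 := h.hasEdgeGrowth_mul_diff hb gP
  have a2 := (h.hasEdgeGrowth_diff gg).bounded_mul (bounded_diff hb)
  have a3 := h.hasEdgeGrowth_mul_diff hb gg
  have a4 := h.hasEdgeGrowth_mul_diff' hb gg
  have a5 := h.hasEdgeGrowth_mul_diff' hl hbu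
  convert h.hasSum_edge (a1.sub a2) using 1
  · ext x
    rw [h.mul_psi₂_log ha hu]
  -- Symmetrisation: the parts with weight u(x) and with weight u(y) have the same sum. Here g = L
  -- log u may be unbounded, so u supplies the bounded factor.
  · have e2 : edgeSum K m (fun x y => (u y - u x) * (g y - g x)) =
        -(2 * edgeSum K m fun x y => u x * (g y - g x)) := by
      have b := h.edgeSum_swap fun x y => u x * (g y - g x)
      have c := h.edgeSum_add a3 (A' := fun x y => u y * (g x - g y)) (by
        obtain ⟨C, h0, hC⟩ := a3
        exact ⟨C, h0, fun x y => (hC y x).trans (le_of_eq (by ring))⟩)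
      rw [b] at c
      rw [two_mul, ← c, ← edgeSum_neg]
      congr 1; ext x y; ring
    -- Both sides equal ∑ m (Lu)(L log u), the right one after integration by parts.
    have e3 : edgeSum K m (fun x y => generator K u x * (v y - v x)) =
        edgeSum K m fun x y => u x * (g y - g x) := by
      have s1 := h.sum_mul_generator a4
      have s2 := h.sum_mul_generator a5
      have s3 : (fun x => m x * (g x * generator K u x)) =
          fun x => m x * (generator K u x * generator K v x) := by
        ext x; rw [mul_comm (g x)]
      rw [s3] at s1
      rw [s2.unique s1, ← h.edgeSum_mul_diff hb gg]
    have e4 : fisherInfoDeriv K m u = edgeSum K m (fun x y =>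
        -(generator K u x * (v y - v x) + u x * (g y - g x) + u x * (P y - P x))) := by
      unfold fisherInfoDeriv
      congr 1; ext x y
      rw [h.generator_div ha hu, h.generator_div ha hu]
      simp only [hv, hg, hP]
      ring
    rw [e4, edgeSum_neg, h.edgeSum_add (a5.add a3) a1, h.edgeSum_add a5 a3, h.edgeSum_sub a1 a2,
      e2, e3]
    ring

/-- The curvature-dimension condition bounds the derivative of the Fisher information, when the
dimension function lies above its tangent at the value of the Fisher information. -/
theorem fisherInfoDeriv_le (h : IsReversible K m) (ha : 0 < a) (hu : ∀ x, u x ∈ Icc a M)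
    (h1 : HasSum (fun x => m x * u x) 1) {κ s : ℝ} {F : ℝ → ℝ} (hCD : CDUpsilon K κ F)
    (hF : ∀ r, F (fisherInfo K m u) + s * (r - fisherInfo K m u) ≤ trivialExtension F r) :
    fisherInfoDeriv K m u ≤ -2 * (κ * fisherInfo K m u + F (fisherInfo K m u)) := by
  set I := fisherInfo K m u
  have s1 := h.hasSum_mul_psi₂ ha hu
  -- Jensen's inequality through the tangent at I: since -L log u has mean I under the probability
  -- weights m u, the affine minorant averages to F(I). Summability of F₀(-L log u) is never
  -- required.
  have s2 := (((h.hasSum_mul_psi ha hu).mul_left κ).add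
    ((h1.mul_left (F I - s * I)).add ((h.hasSum_mul_generator_log ha hu).mul_left s))).mul_left 2
  have := hasSum_le (fun x => ?_) s2 s1
  · linarith
  · have e1 := hCD x (fun x => Real.log (u x)) (isBoundedFun_log ha hu)
    have e2 := hF (-generator K (fun x => Real.log (u x)) x)
    have := mul_nonneg (h.pos x).le (ha.le.trans (hu x).1)
    nlinarith [mul_le_mul_of_nonneg_left (e2.trans (le_sub_iff_add_le'.2 e1)) this]

end IsReversible

end

/-! ### Entropy, Fisher information and convergence along the heat flow -/

noncomputable section

open Filter Topology

/-- A bounded solution `u` of the backward equation `∂ₜ u = L u` on `[0,∞)`. -/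
structure IsHeatFlow {X : Type*} (K : X → X → ℝ) (u : ℝ → X → ℝ) : Prop where
  bounded : ∃ C, 0 ≤ C ∧ ∀ t, 0 ≤ t → ∀ x, |u t x| ≤ C
  continuousOn : ∀ x, ContinuousOn (fun t => u t x) (Ici 0)
  hasDerivAt : ∀ x t, 0 < t → HasDerivAt (fun t => u t x) (generator K (u t) x) t

variable {X : Type*} {K : X → X → ℝ} {m : X → ℝ}

theorem generator_const (c : ℝ) (x : X) : generator K (fun _ => c) x = 0 := by
  simp [generator]

theorem isHeatFlow_const (c : ℝ) : IsHeatFlow K fun _ _ => c where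
  bounded := ⟨|c|, abs_nonneg c, fun _ _ _ => le_rfl⟩
  continuousOn _ := continuousOn_const
  hasDerivAt x t _ := by rw [generator_const]; exact hasDerivAt_const t c

theorem HasEdgeGrowth.congr {A A' : X → X → ℝ} (hA : HasEdgeGrowth K A)
    (e : ∀ x y, A x y = A' x y) : HasEdgeGrowth K A' := by
  rwa [← funext fun x => funext (e x)]

namespace IsHeatFlow

variable {u w : ℝ → X → ℝ} {a M : ℝ}

theorem isBoundedFun (hu : IsHeatFlow K u) {t : ℝ} (ht : 0 ≤ t) : IsBoundedFun (u t) := by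
  obtain ⟨C, -, hC⟩ := hu.bounded
  exact ⟨C, hC t ht⟩

/-- The flows of two solutions are symmetric in `ℓ²(m)`. -/
theorem sum_mul_symm (hu : IsHeatFlow K u) (h : IsReversible K m) (hw : IsHeatFlow K w)
    {T : ℝ} (hT : 0 < T) :
    ∑' x, m x * (u T x * w 0 x) = ∑' x, m x * (u 0 x * w T x) := by
  obtain ⟨C, hC0, hC⟩ := hu.bounded
  obtain ⟨D, hD0, hD⟩ := hw.bounded
  have hbd : ∀ s ∈ Icc 0 T, ∀ x, ‖m x * (u s x * w (T - s) x)‖ ≤ m x * (C * D) := by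
    intro s hs x
    rw [norm_mul, Real.norm_of_nonneg (h.pos x).le, norm_mul]
    exact mul_le_mul_of_nonneg_left (mul_le_mul (hC s hs.1 x) (hD _ (by linarith [hs.2]) x)
      (norm_nonneg _) hC0) (h.pos x).le
  have hsum : Summable fun x => m x * (C * D) := h.hasSum_one.summable.mul_right _
  have hcont : ContinuousOn (fun s => ∑' x, m x * (u s x * w (T - s) x)) (Icc 0 T) := by
    refine continuousOn_tsum (fun x => ?_) hsum fun x s hs => hbd s hs x
    refine continuousOn_const.mul (((hu.continuousOn x).mono Icc_subset_Ici_self).mul ?_)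
    exact (hw.continuousOn x).comp (continuousOn_const.sub continuousOn_id)
      fun s hs => by simpa using hs.2
  -- The pairing of u(s) with w(T - s) is constant in s: its derivative is the difference of the
  -- pairings of Lu with w and of u with Lw, which cancel by integration by parts.
  have hder : ∀ s ∈ Ioo 0 T, HasDerivAt (fun s => ∑' x, m x * (u s x * w (T - s) x)) 0 s := by
    intro s hs
    have key := hasDerivAt_tsum_of_isPreconnected (t := Ioo 0 T)
      (g := fun x s => m x * (u s x * w (T - s) x))
      (g' := fun x s => m x * (generator K (u s) x * w (T - s) x +
        u s x * -generator K (w (T - s)) x))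
      (u := fun x => m x * rate K x * (4 * C * D)) (h.summable_rate.mul_right _)
      isOpen_Ioo isPreconnected_Ioo (fun x s hs => ?_) (fun x s hs => ?_) hs
      (Summable.of_norm_bounded hsum fun x => hbd s (Ioo_subset_Icc_self hs) x) hs
    · refine key.congr_deriv ?_
      have b1 := hu.isBoundedFun hs.1.le
      have b2 := hw.isBoundedFun (sub_pos.2 hs.2).le
      have e1 := h.sum_mul_generator (h.hasEdgeGrowth_mul_diff b2 (h.hasRateGrowth_of_bounded b1))
      have e2 := h.sum_mul_generator (h.hasEdgeGrowth_mul_diff b1 (h.hasRateGrowth_of_bounded b2))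
      rw [h.edgeSum_mul_diff b2 (h.hasRateGrowth_of_bounded b1)] at e1
      have e3 := e1.sub e2
      rw [sub_self] at e3
      rw [← e3.tsum_eq]
      exact tsum_congr fun x => by ring
    · have d1 := hu.hasDerivAt x s hs.1
      have d2 : HasDerivAt (fun s => w (T - s) x) (-generator K (w (T - s)) x) s :=
        (hw.hasDerivAt x (T - s) (sub_pos.2 hs.2)).comp_const_sub T s
      exact (d1.mul d2).const_mul (m x)
    · have b1 := h.generator_abs_le (hC s hs.1.le) x
      have b2 := h.generator_abs_le (hD (T - s) (sub_pos.2 hs.2).le) x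
      have b3 := hC s hs.1.le x
      have b4 := hD (T - s) (sub_pos.2 hs.2).le x
      rw [norm_mul, Real.norm_of_nonneg (h.pos x).le, Real.norm_eq_abs, mul_assoc]
      refine mul_le_mul_of_nonneg_left ((abs_add_le _ _).trans ?_) (h.pos x).le
      rw [abs_mul, abs_mul, abs_neg]
      have hq := h.rate_nonneg x
      have c1 := mul_le_mul b1 b4 (abs_nonneg _) (by positivity)
      have c2 := mul_le_mul b3 b2 (abs_nonneg _) hC0
      linarith
  obtain ⟨c, -, hc⟩ := exists_hasDerivAt_eq_slope _ (fun _ => 0) hT hcont hder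
  have : (∑' x, m x * (u T x * w (T - T) x)) - ∑' x, m x * (u 0 x * w (T - 0) x) = 0 := by
    rcases div_eq_zero_iff.1 hc.symm with e | e
    · exact e
    · linarith
  simpa [sub_eq_zero] using this

theorem sum_eq (hu : IsHeatFlow K u) (h : IsReversible K m) {T : ℝ} (hT : 0 < T) :
    ∑' x, m x * u T x = ∑' x, m x * u 0 x := by
  simpa using hu.sum_mul_symm h (isHeatFlow_const 1) hT

/-- Termwise, the derivative is m (1 + log u) Lu; integration by parts removes the 1. The two-sided
bounds on u keep the logarithm bounded, so a multiple of m · rate dominates uniformly in time. -/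
theorem hasDerivAt_relEntropy (hu : IsHeatFlow K u) (h : IsReversible K m) (ha : 0 < a)
    (hab : ∀ t, 0 ≤ t → ∀ x, u t x ∈ Icc a M) {t : ℝ} (ht : 0 < t) :
    HasDerivAt (fun t => relEntropy m (u t)) (-fisherInfo K m (u t)) t := by
  obtain ⟨C, hC0, hC⟩ := hu.bounded
  set Λ := |Real.log a| + |Real.log M| with hΛ
  have hΛ0 : 0 ≤ Λ := by positivity
  have hlog : ∀ s, 0 ≤ s → ∀ x, |Real.log (u s x)| ≤ Λ := fun s hs x =>
    abs_log_le ha (hab s hs x).1 (hab s hs x).2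
  have key := hasDerivAt_tsum_of_isPreconnected (t := Ioi 0)
      (g := fun x s => m x * (u s x * Real.log (u s x)))
      (g' := fun x s => m x * ((1 + Real.log (u s x)) * generator K (u s) x))
      (u := fun x => m x * rate K x * ((1 + Λ) * (2 * C))) (y := t) (h.summable_rate.mul_right _)
      isOpen_Ioi isPreconnected_Ioi (fun x s hs => ?_) (fun x s hs => ?_) ht
      (Summable.of_norm_bounded (h.hasSum_one.summable.mul_right (C * Λ)) fun x => ?_) ht
  · refine key.congr_deriv ?_
    have b1 := hu.isBoundedFun ht.le
    have b2 : IsBoundedFun fun x => 1 + Real.log (u t x) :=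
      ⟨1 + Λ, fun x => (abs_add_le _ _).trans (by simpa using hlog t ht.le x)⟩
    rw [(h.sum_mul_generator (h.hasEdgeGrowth_mul_diff b2
      (h.hasRateGrowth_of_bounded b1))).tsum_eq, h.edgeSum_mul_diff b2
      (h.hasRateGrowth_of_bounded b1), fisherInfo, ← IsReversible.edgeSum_neg]
    congr 1; ext x y; ring
  · have d := hu.hasDerivAt x s hs
    have hpos : 0 < u s x := ha.trans_le (hab s (le_of_lt hs) x).1
    refine ((d.mul (d.log hpos.ne')).const_mul (m x)).congr_deriv ?_
    field_simp
    ring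
  · have b1 := h.generator_abs_le (hC s (le_of_lt hs)) x
    have b2 : |1 + Real.log (u s x)| ≤ 1 + Λ :=
      (abs_add_le _ _).trans (by simpa using hlog s (le_of_lt hs) x)
    rw [norm_mul, Real.norm_of_nonneg (h.pos x).le, Real.norm_eq_abs, mul_assoc, abs_mul]
    refine mul_le_mul_of_nonneg_left ?_ (h.pos x).le
    have := mul_le_mul b2 b1 (abs_nonneg _) (by positivity)
    linarith
  · rw [norm_mul, Real.norm_of_nonneg (h.pos x).le, norm_mul]
    exact mul_le_mul_of_nonneg_left (mul_le_mul (hC t ht.le x) (hlog t ht.le x)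
      (norm_nonneg _) hC0) (h.pos x).le

/-- Differentiation is carried out edge by edge. Since u ≥ a, the derivative Lu/u of log u has rate
growth, so `summable_edge_growth` provides the dominating series. -/
theorem hasDerivAt_fisherInfo (hu : IsHeatFlow K u) (h : IsReversible K m) (ha : 0 < a)
    (hab : ∀ t, 0 ≤ t → ∀ x, u t x ∈ Icc a M) {t : ℝ} (ht : 0 < t) :
    HasDerivAt (fun t => fisherInfo K m (u t)) (fisherInfoDeriv K m (u t)) t := by
  obtain ⟨C, hC0, hC⟩ := hu.bounded
  set Λ := |Real.log a| + |Real.log M| with hΛ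
  have hΛ0 : 0 ≤ Λ := by positivity
  have hlog : ∀ s, 0 ≤ s → ∀ x, |Real.log (u s x)| ≤ Λ := fun s hs x =>
    abs_log_le ha (hab s hs x).1 (hab s hs x).2
  have hg : ∀ s, 0 ≤ s → ∀ x, |generator K (u s) x / u s x| ≤ 2 * C / a * rate K x := by
    intro s hs x
    rw [abs_div, abs_of_pos (ha.trans_le (hab s hs x).1)]
    have hq := h.rate_nonneg x
    calc _ ≤ (2 * C * rate K x) / a :=
          div_le_div₀ (by positivity) (h.generator_abs_le (hC s hs) x) ha (hab s hs x).1
      _ = _ := by ring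
  have key := hasDerivAt_tsum_of_isPreconnected (t := Ioi 0)
      (g := fun (p : X × X) s => m p.1 * K p.1 p.2 *
        (u s p.1 * (Real.log (u s p.1) - Real.log (u s p.2))))
      (g' := fun p s => m p.1 * K p.1 p.2 *
        (generator K (u s) p.1 * (Real.log (u s p.1) - Real.log (u s p.2)) +
        u s p.1 * (generator K (u s) p.1 / u s p.1 - generator K (u s) p.2 / u s p.2)))
      (u := fun p => m p.1 * K p.1 p.2 * (1 + rate K p.1 + rate K p.2) *
        (2 * C * (2 * Λ) + C * (2 * C / a))) (y := t) (h.summable_edge_growth.mul_right _)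
      isOpen_Ioi isPreconnected_Ioi (fun p s hs => ?_) (fun p s hs => ?_) ht
      ?_ ht
  · exact key
  · have d1 := hu.hasDerivAt p.1 s hs
    have d2 := hu.hasDerivAt p.2 s hs
    have h1 : 0 < u s p.1 := ha.trans_le (hab s (le_of_lt hs) _).1
    have h2 : 0 < u s p.2 := ha.trans_le (hab s (le_of_lt hs) _).1
    exact (d1.mul ((d1.log h1.ne').sub (d2.log h2.ne'))).const_mul _
  · have hs' : 0 ≤ s := le_of_lt hs
    have hmk := mul_nonneg (h.pos p.1).le (h.nonneg p.1 p.2)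
    rw [norm_mul, Real.norm_of_nonneg hmk, Real.norm_eq_abs, mul_assoc (m p.1 * K p.1 p.2)]
    refine mul_le_mul_of_nonneg_left ((abs_add_le _ _).trans ?_) hmk
    rw [abs_mul, abs_mul]
    have hq := h.rate_nonneg p.1
    have hq' := h.rate_nonneg p.2
    have b1 := mul_le_mul (h.generator_abs_le (hC s hs') p.1)
      ((abs_sub (Real.log (u s p.1)) (Real.log (u s p.2))).trans
        (add_le_add (hlog s hs' _) (hlog s hs' _))) (abs_nonneg _) (by positivity)
    have b2 := mul_le_mul (hC s hs' p.1)
      ((abs_sub (generator K (u s) p.1 / u s p.1) (generator K (u s) p.2 / u s p.2)).trans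
        (add_le_add (hg s hs' _) (hg s hs' _))) (abs_nonneg _) hC0
    have e1 : 0 ≤ C * Λ * (1 + rate K p.2) := by positivity
    have e2 : 0 ≤ C * (2 * C / a) := by positivity
    nlinarith
  · refine h.summable_edge
      (A := fun x y => u t x * (Real.log (u t x) - Real.log (u t y)))
      (((h.hasEdgeGrowth_diff (h.hasRateGrowth_of_bounded
      (f := fun x => Real.log (u t x)) ⟨Λ, hlog t ht.le⟩)).neg.bounded_mul
      (b := fun x _ => u t x) ⟨C, hC0, fun x _ => hC t ht.le x⟩).congr fun x y => ?_)
    ring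

end IsHeatFlow

/-- Decay of a nonnegative function with `J' ≤ -2 J^{1+δ} / n`, uniformly in its initial value. -/
theorem le_of_deriv_le_neg_rpow {J J' : ℝ → ℝ} {δ n : ℝ} (hδ : 0 < δ) (hn : 0 < n)
    (hJ : ∀ t, 0 < t → HasDerivAt J (J' t) t) (h0 : ∀ t, 0 < t → 0 ≤ J t)
    (hJ' : ∀ t, 0 < t → J' t ≤ -2 * (J t ^ (1 + δ) / n)) {t : ℝ} (ht : 0 < t) :
    J t ≤ (n / (2 * δ * t)) ^ (1 / δ) := by
  rcases (h0 t ht).eq_or_lt with e | hpos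
  · rw [← e]; positivity
  -- Monotonicity carries positivity of J from t back to all earlier times, so that J^{-δ} may be
  -- differentiated on (0, t].
  have hanti : AntitoneOn J (Ioi 0) := by
    refine antitoneOn_of_deriv_nonpos (convex_Ioi 0)
      (fun s hs => (hJ s hs).continuousAt.continuousWithinAt) ?_ ?_
    · rw [interior_Ioi]
      exact fun s hs => (hJ s hs).differentiableAt.differentiableWithinAt
    · rw [interior_Ioi]
      intro s hs
      rw [(hJ s hs).deriv]
      have : 0 ≤ J s ^ (1 + δ) / n := div_nonneg (Real.rpow_nonneg (h0 s hs) _) hn.le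
      linarith [hJ' s hs]
  have hposs : ∀ s ∈ Ioc 0 t, 0 < J s := fun s hs => hpos.trans_le (hanti hs.1 ht hs.2)
  have hd : ∀ s ∈ Ioc 0 t, HasDerivAt (fun s => J s ^ (-δ) - 2 * δ / n * s)
      (J' s * -δ * J s ^ (-δ - 1) - 2 * δ / n) s := fun s hs => by
    refine (((hJ s hs.1).rpow_const (p := -δ) (Or.inl (hposs s hs).ne')).sub
      ((hasDerivAt_id s).const_mul (2 * δ / n))).congr_deriv ?_
    rw [mul_one]
  -- The Bernoulli substitution: the differential inequality is equivalent to (J^{-δ})' ≥ 2δ/n.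
  have hmono : MonotoneOn (fun s => J s ^ (-δ) - 2 * δ / n * s) (Ioc 0 t) := by
    refine monotoneOn_of_deriv_nonneg (convex_Ioc 0 t)
      (fun s hs => (hd s hs).continuousAt.continuousWithinAt) ?_ ?_
    · exact fun s hs => (hd s (interior_subset hs)).differentiableAt.differentiableWithinAt
    · intro s hs
      have hs := interior_subset hs
      rw [(hd s hs).deriv]
      have hp := hposs s hs
      have e : J s ^ (1 + δ) * J s ^ (-δ - 1) = 1 := by
        rw [← Real.rpow_add hp, show 1 + δ + (-δ - 1) = 0 by ring, Real.rpow_zero]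
      have hr : 0 < J s ^ (-δ - 1) := Real.rpow_pos_of_pos hp _
      have := mul_le_mul_of_nonneg_right (hJ' s hs.1) (mul_pos hδ hr).le
      have e2 : -2 * (J s ^ (1 + δ) / n) * (δ * J s ^ (-δ - 1)) = -(2 * δ / n) := by
        rw [show -2 * (J s ^ (1 + δ) / n) * (δ * J s ^ (-δ - 1)) =
          -(2 * δ / n) * (J s ^ (1 + δ) * J s ^ (-δ - 1)) by ring, e, mul_one]
      linarith
  have hlow : 2 * δ / n * t ≤ J t ^ (-δ) := by
    refine le_of_forall_pos_le_add fun ε hε => ?_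
    have hc : 0 < 2 * δ / n := by positivity
    -- The start time s is so small that 2δs/n ≤ ε; discarding J(s)^{-δ} > 0 removes all dependence
    -- on the initial value.
    set s := min t (ε / (2 * δ / n)) with hs
    have hs0 : 0 < s := lt_min ht (by positivity)
    have hse : 2 * δ / n * s ≤ ε := by
      have : s ≤ ε / (2 * δ / n) := min_le_right _ _
      rwa [le_div_iff₀ hc, mul_comm] at this
    have := hmono ⟨hs0, min_le_left _ _⟩ ⟨ht, le_rfl⟩ (min_le_left _ _)
    have h1 : 0 < J s ^ (-δ) := Real.rpow_pos_of_pos (hposs s ⟨hs0, min_le_left _ _⟩) _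
    simp only at this
    linarith
  have hδJ : J t ^ δ ≤ n / (2 * δ * t) := by
    rw [Real.rpow_neg hpos.le] at hlow
    have h2 : 0 < J t ^ δ := Real.rpow_pos_of_pos hpos _
    rw [le_div_iff₀ (by positivity)]
    have := mul_le_mul_of_nonneg_left hlow (mul_pos hn h2).le
    have e1 : n * J t ^ δ * (J t ^ δ)⁻¹ = n := by field_simp
    have e2 : n * J t ^ δ * (2 * δ / n * t) = J t ^ δ * (2 * δ * t) := by field_simp
    linarith
  calc J t = (J t ^ δ) ^ (1 / δ) := by
        rw [← Real.rpow_mul hpos.le, mul_one_div_cancel hδ.ne', Real.rpow_one]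
    _ ≤ _ := Real.rpow_le_rpow (Real.rpow_nonneg hpos.le _) hδJ (by positivity)

namespace IsHeatFlow

variable {u : ℝ → X → ℝ} {a M : ℝ}

/-- A single edge with positive rate contributes at least m(x) K(x,y) a (√(u(y)/u(x)) - 1)² to the
Fisher information, so the ratio of u across it tends to 1. In the proof, `s` is this square root.
-/
theorem tendsto_edge (h : IsReversible K m) (ha : 0 < a)
    (hab : ∀ t, 0 ≤ t → ∀ x, u t x ∈ Icc a M)
    (hI : Tendsto (fun t => fisherInfo K m (u t)) atTop (𝓝 0)) {x y : X} (hxy : 0 < K x y) :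
    Tendsto (fun t => u t y - u t x) atTop (𝓝 0) := by
  set s : ℝ → ℝ := fun t => Real.exp ((Real.log (u t y) - Real.log (u t x)) / 2) with hs
  have hc : 0 < m x * K x y * a := mul_pos (mul_pos (h.pos x) hxy) ha
  have h1 : Tendsto (fun t => (s t - 1) ^ 2) atTop (𝓝 0) := by
    refine squeeze_zero' (g := fun t => fisherInfo K m (u t) / (m x * K x y * a))
      (Eventually.of_forall fun t => sq_nonneg _) ?_ (by simpa using hI.div_const _)
    filter_upwards [eventually_ge_atTop 0] with t ht
    rw [le_div_iff₀ hc]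
    have e := h.edge_le_fisherInfo ha (hab t ht) x y
    have e1 := sq_le_upsilon (Real.log (u t y) - Real.log (u t x))
    have e2 := mul_le_mul (hab t ht x).1 e1 (sq_nonneg _) (ha.le.trans (hab t ht x).1)
    have := mul_le_mul_of_nonneg_left e2 (mul_pos (h.pos x) hxy).le
    simp only [hs]
    linarith
  have h2 : Tendsto s atTop (𝓝 1) := by
    have := (Real.continuous_sqrt.tendsto 0).comp h1
    simp only [Function.comp_def, Real.sqrt_sq_eq_abs, Real.sqrt_zero] at this
    have := (tendsto_zero_iff_abs_tendsto_zero _).2 this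
    simpa using this.add_const 1
  have h3 : Tendsto (fun t => M * |s t ^ 2 - 1|) atTop (𝓝 0) := by
    simpa using (((h2.pow 2).sub_const 1).abs).const_mul M
  refine squeeze_zero_norm' ?_ h3
  filter_upwards [eventually_ge_atTop 0] with t ht
  have hx : 0 < u t x := ha.trans_le (hab t ht x).1
  have hy : 0 < u t y := ha.trans_le (hab t ht y).1
  have e : u t y - u t x = u t x * (s t ^ 2 - 1) := by
    simp only [hs]
    rw [← Real.exp_nat_mul]
    push_cast
    rw [mul_div_cancel₀ _ two_ne_zero, Real.exp_sub, Real.exp_log hx, Real.exp_log hy]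
    field_simp
  rw [e, norm_mul, Real.norm_of_nonneg hx.le]
  exact mul_le_mul_of_nonneg_right (hab t ht x).2 (abs_nonneg _)

/-- Irreducibility chains edges together, so u(y) - u(x) → 0 for every y. Averaging over y by
dominated convergence identifies the limit, because the mass stays 1. -/
theorem tendsto_one (hu : IsHeatFlow K u) (h : IsReversible K m) (ha : 0 < a)
    (hab : ∀ t, 0 ≤ t → ∀ x, u t x ∈ Icc a M) (h1 : ∑' x, m x * u 0 x = 1)
    (hirr : ∀ x y, Relation.ReflTransGen (fun a b => 0 < K a b) x y)
    (hI : Tendsto (fun t => fisherInfo K m (u t)) atTop (𝓝 0)) (x : X) :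
    Tendsto (fun t => u t x) atTop (𝓝 1) := by
  obtain ⟨C, hC0, hC⟩ := hu.bounded
  have hd : ∀ y, Tendsto (fun t => u t y - u t x) atTop (𝓝 0) := fun y => by
    induction hirr x y with
    | refl => simp
    | tail _ e ih => simpa using ih.add (tendsto_edge h ha hab hI e)
  have h2 : Tendsto (fun t => ∑' y, m y * (u t y - u t x)) atTop (𝓝 (∑' y : X, m y * 0)) := by
    refine tendsto_tsum_of_dominated_convergence (h.hasSum_one.summable.mul_right (2 * C))
      (fun y => (hd y).const_mul _) ?_
    filter_upwards [eventually_ge_atTop 0] with t ht y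
    rw [norm_mul, Real.norm_of_nonneg (h.pos y).le]
    refine mul_le_mul_of_nonneg_left ((abs_sub _ _).trans ?_) (h.pos y).le
    linarith [hC t ht x, hC t ht y]
  simp only [mul_zero, tsum_zero] at h2
  have h3 := h2.const_sub 1
  rw [sub_zero] at h3
  refine h3.congr' ?_
  filter_upwards [eventually_gt_atTop 0] with t ht
  have s1 : Summable fun y => m y * u t y :=
    Summable.of_norm_bounded (h.hasSum_one.summable.mul_right C) fun y => by
      rw [norm_mul, Real.norm_of_nonneg (h.pos y).le]
      exact mul_le_mul_of_nonneg_left (hC t ht.le y) (h.pos y).le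
  simp only [mul_sub]
  rw [s1.tsum_sub (h.hasSum_one.summable.mul_right _), hu.sum_eq h ht, h1, tsum_mul_right,
    h.hasSum_one.tsum_eq]
  ring

theorem tendsto_relEntropy (hu : IsHeatFlow K u) (h : IsReversible K m) (ha : 0 < a)
    (hab : ∀ t, 0 ≤ t → ∀ x, u t x ∈ Icc a M) (h1 : ∑' x, m x * u 0 x = 1)
    (hirr : ∀ x y, Relation.ReflTransGen (fun a b => 0 < K a b) x y)
    (hI : Tendsto (fun t => fisherInfo K m (u t)) atTop (𝓝 0)) :
    Tendsto (fun t => relEntropy m (u t)) atTop (𝓝 0) := by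
  obtain ⟨C, hC0, hC⟩ := hu.bounded
  have h2 : Tendsto (fun t => relEntropy m (u t)) atTop
      (𝓝 (∑' x, m x * (1 * Real.log 1))) := by
    refine tendsto_tsum_of_dominated_convergence
      (h.hasSum_one.summable.mul_right (C * (|Real.log a| + |Real.log M|)))
      (fun x => ?_) ?_
    · have := hu.tendsto_one h ha hab h1 hirr hI x
      exact (this.mul (this.log one_ne_zero)).const_mul _
    · filter_upwards [eventually_ge_atTop 0] with t ht x
      rw [norm_mul, Real.norm_of_nonneg (h.pos x).le, norm_mul]
      exact mul_le_mul_of_nonneg_left (mul_le_mul (hC t ht x)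
        (abs_log_le ha (hab t ht x).1 (hab t ht x).2) (norm_nonneg _) hC0) (h.pos x).le
  simpa using h2

end IsHeatFlow

end

/-! ### The growth function, entropy decay and the Gibbs inequality -/

noncomputable section

open Filter Topology

/-- `∫₀^r dy / (2 (κ + y^δ / n))`. -/
def entropyGrowth (κ δ n r : ℝ) : ℝ :=
  ∫ y in (0 : ℝ)..r, 1 / (2 * (κ + |y| ^ δ / n))

section Growth

variable {κ δ n : ℝ}

theorem entropyGrowth_denom_pos (hκ : 0 < κ) (hn : 0 < n) (y : ℝ) :
    0 < 2 * (κ + |y| ^ δ / n) := by positivity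

/-- The absolute value keeps the denominator positive on the whole line, so `entropyGrowth` is
differentiable everywhere, also at 0. -/
theorem continuous_entropyGrowth_integrand (hκ : 0 < κ) (hδ : 0 < δ) (hn : 0 < n) :
    Continuous fun y : ℝ => 1 / (2 * (κ + |y| ^ δ / n)) :=
  continuous_const.div (continuous_const.mul (continuous_const.add
    ((continuous_abs.rpow_const fun _ => Or.inr hδ.le).div_const n)))
    fun y => (entropyGrowth_denom_pos hκ hn y).ne'

theorem hasDerivAt_entropyGrowth (hκ : 0 < κ) (hδ : 0 < δ) (hn : 0 < n) (r : ℝ) :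
    HasDerivAt (entropyGrowth κ δ n) (1 / (2 * (κ + |r| ^ δ / n))) r :=
  ((continuous_entropyGrowth_integrand hκ hδ hn).integral_hasStrictDerivAt 0 r).hasDerivAt

theorem entropyGrowth_zero : entropyGrowth κ δ n 0 = 0 := intervalIntegral.integral_same

theorem monotone_entropyGrowth (hκ : 0 < κ) (hδ : 0 < δ) (hn : 0 < n) :
    Monotone (entropyGrowth κ δ n) :=
  monotone_of_hasDerivAt_nonneg (hasDerivAt_entropyGrowth hκ hδ hn)
    fun r => (one_div_pos.2 (entropyGrowth_denom_pos hκ hn r)).le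

/-- Substitution y = c/v with c = (κn)^{1/δ}: since c^δ = κn, the denominator κ + y^δ/n becomes κ(1
+ v^{-δ}), and v = ∞ corresponds to y = 0. -/
theorem growthFun_eq_entropyGrowth (hκ : 0 < κ) (hδ : 0 < δ) (hn : 0 < n) {r : ℝ} (hr : 0 < r) :
    growthFun κ δ n r = entropyGrowth κ δ n r := by
  set c := (κ * n) ^ (1 / δ) with hc
  have hκn : 0 < κ * n := mul_pos hκ hn
  have hc0 : 0 < c := Real.rpow_pos_of_pos hκn _
  have hcδ : c ^ δ = κ * n := by
    rw [hc, ← Real.rpow_mul hκn.le, one_div_mul_cancel hδ.ne', Real.rpow_one]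
  have hcr : 0 < c / r := div_pos hc0 hr
  have hd : ∀ v : ℝ, 0 < v → HasDerivAt (fun v => -entropyGrowth κ δ n (c / v))
      (c / (2 * κ) * (v ^ (δ - 2) / (v ^ δ + 1))) v := by
    intro v hv
    have d1 : HasDerivAt (fun v => c / v) (-c / v ^ 2) v := by
      simpa using (hasDerivAt_const v c).fun_div (hasDerivAt_id v) hv.ne'
    refine ((hasDerivAt_entropyGrowth hκ hδ hn (c / v)).comp v d1).neg.congr_deriv ?_
    have hvδ : 0 < v ^ δ := Real.rpow_pos_of_pos hv _
    rw [abs_of_pos (div_pos hc0 hv), Real.div_rpow hc0.le hv.le, hcδ, Real.rpow_sub hv,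
      Real.rpow_two]
    field_simp
  have key := integral_Ioi_of_hasDerivAt_of_nonneg (a := c / r) (l := 0)
    (hd _ hcr).continuousAt.continuousWithinAt (fun v hv => hd v (hcr.trans hv))
    (fun v hv => by have : 0 < v := hcr.trans hv; positivity) ?_
  · rw [growthFun, ← integral_const_mul, key, div_div_cancel₀ hc0.ne']
    ring
  · have h1 : Tendsto (fun v : ℝ => c / v) atTop (𝓝 0) := tendsto_const_nhds.div_atTop tendsto_id
    have h2 := ((hasDerivAt_entropyGrowth hκ hδ hn 0).continuousAt.tendsto.comp h1).neg
    rw [entropyGrowth_zero, neg_zero] at h2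
    exact h2

theorem entropyGrowth_one (hκ : 0 < κ) (hn : 0 < n) {r : ℝ} (hr : 0 ≤ r) :
    entropyGrowth κ 1 n r = n / 2 * Real.log (1 + r / (κ * n)) := by
  have hd : ∀ y ∈ uIcc 0 r, HasDerivAt (fun y => n / 2 * Real.log (1 + y / (κ * n)))
      (1 / (2 * (κ + |y| ^ (1 : ℝ) / n))) y := by
    intro y hy
    rw [uIcc_of_le hr] at hy
    have hy0 : 0 ≤ y := hy.1
    have hp : 0 < 1 + y / (κ * n) := by positivity
    refine (((((hasDerivAt_id y).div_const (κ * n)).const_add 1).log hp.ne').const_mul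
      (n / 2)).congr_deriv ?_
    rw [abs_of_nonneg hy0, Real.rpow_one, id]
    field_simp
  rw [entropyGrowth, intervalIntegral.integral_eq_sub_of_hasDerivAt hd
    ((continuous_entropyGrowth_integrand hκ one_pos hn).intervalIntegrable _ _)]
  simp

/-- The trivial extension of `r ↦ r^{1+δ} / n` lies above its tangents. -/
theorem rpow_tangent_le (hδ : 0 < δ) (hn : 0 < n) {b : ℝ} (hb : 0 ≤ b) (r : ℝ) :
    b ^ (1 + δ) / n + (1 + δ) * b ^ δ / n * (r - b) ≤
      trivialExtension (fun r => r ^ (1 + δ) / n) r := by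
  have e : b ^ (1 + δ) = b * b ^ δ := by
    rw [Real.rpow_add_of_nonneg hb zero_le_one hδ.le, Real.rpow_one]
  have hbδ : 0 ≤ b ^ δ := Real.rpow_nonneg hb _
  rw [trivialExtension, show b ^ (1 + δ) / n + (1 + δ) * b ^ δ / n * (r - b) =
    (b ^ (1 + δ) + (1 + δ) * b ^ δ * (r - b)) / n by ring]
  by_cases hr : 0 ≤ r
  · rw [indicator_of_mem (mem_Ici.2 hr)]
    refine div_le_div_of_nonneg_right ?_ hn.le
    rcases hb.eq_or_lt with h0 | h0
    · rw [← h0, Real.zero_rpow (by linarith), Real.zero_rpow hδ.ne']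
      simpa using Real.rpow_nonneg hr _
    -- Bernoulli's inequality for (r/b)^{1+δ}, scaled by b^{1+δ}, is the tangent inequality at b.
    · have h1 := one_add_mul_self_le_rpow_one_add (s := r / b - 1) (p := 1 + δ)
        (by linarith [div_nonneg hr hb]) (by linarith)
      rw [add_sub_cancel, Real.div_rpow hr hb, le_div_iff₀ (Real.rpow_pos_of_pos h0 _)] at h1
      refine le_trans (le_of_eq ?_) h1
      rw [e]
      field_simp
  · rw [indicator_of_notMem (by simpa using hr)]
    refine div_nonpos_of_nonpos_of_nonneg ?_ hn.le
    rw [e]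
    push Not at hr
    nlinarith [mul_nonneg hbδ hb, mul_nonneg hbδ (neg_nonneg.2 hr.le),
      mul_nonneg hδ.le (mul_nonneg hbδ hb), mul_nonneg hδ.le (mul_nonneg hbδ (neg_nonneg.2 hr.le))]

end Growth

variable {X : Type*} {K : X → X → ℝ} {m : X → ℝ}

/-- Entropy decay along the heat flow under the curvature-dimension condition, uniformly in the
initial value. -/
theorem IsHeatFlow.relEntropy_le {u : ℝ → X → ℝ} {a M : ℝ} (hu : IsHeatFlow K u)
    (h : IsReversible K m) (hirr : ∀ x y, Relation.ReflTransGen (fun a b => 0 < K a b) x y)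
    {κ δ n : ℝ} (hκ : 0 < κ) (hδ : 0 < δ) (hn : 0 < n)
    (hCD : CDUpsilon K κ fun r => r ^ (1 + δ) / n) (ha : 0 < a)
    (hab : ∀ t, 0 ≤ t → ∀ x, u t x ∈ Icc a M) (h1 : ∑' x, m x * u 0 x = 1) {t : ℝ} (ht : 0 < t) :
    relEntropy m (u t) ≤ entropyGrowth κ δ n ((n / (2 * δ * t)) ^ (1 / δ)) := by
  obtain ⟨C, hC0, hC⟩ := hu.bounded
  have hmass : ∀ s, 0 < s → HasSum (fun x => m x * u s x) 1 := by
    intro s hs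
    rw [← h1, ← hu.sum_eq h hs]
    refine (Summable.of_norm_bounded (h.hasSum_one.summable.mul_right C) fun y => ?_).hasSum
    rw [norm_mul, Real.norm_of_nonneg (h.pos y).le]
    exact mul_le_mul_of_nonneg_left (hC s hs.le y) (h.pos y).le
  set J : ℝ → ℝ := fun s => fisherInfo K m (u s) with hJ
  have hJ0 : ∀ s, 0 < s → 0 ≤ J s := fun s hs => h.fisherInfo_nonneg ha (hab s hs.le)
  have hJd : ∀ s, 0 < s → HasDerivAt J (fisherInfoDeriv K m (u s)) s :=
    fun s hs => hu.hasDerivAt_fisherInfo h ha hab hs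
  have hle : ∀ s, 0 < s → fisherInfoDeriv K m (u s) ≤ -2 * (κ * J s + J s ^ (1 + δ) / n) :=
    fun s hs => h.fisherInfoDeriv_le ha (hab s hs.le) (hmass s hs) hCD
      fun r => rpow_tangent_le hδ hn (hJ0 s hs) r
  have hbound : ∀ s, 0 < s → J s ≤ (n / (2 * δ * s)) ^ (1 / δ) := fun s hs =>
    le_of_deriv_le_neg_rpow hδ hn hJd hJ0
      (fun s hs => by linarith [hle s hs, mul_nonneg hκ.le (hJ0 s hs)]) hs
  have hlim : Tendsto J atTop (𝓝 0) := by
    refine squeeze_zero' (g := fun s => (n / (2 * δ * s)) ^ (1 / δ)) ?_ ?_ ?_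
    · filter_upwards [eventually_gt_atTop 0] with s hs using hJ0 s hs
    · filter_upwards [eventually_gt_atTop 0] with s hs using hbound s hs
    · have h3 : Tendsto (fun s : ℝ => n / (2 * δ * s)) atTop (𝓝 0) :=
        tendsto_const_nhds.div_atTop (tendsto_id.const_mul_atTop (by positivity))
      have h4 := h3.rpow_const (p := 1 / δ) (Or.inr (by positivity))
      rwa [Real.zero_rpow (by positivity)] at h4
  have hG : ∀ s ∈ Ioi (0 : ℝ), HasDerivAt (fun s => relEntropy m (u s) - entropyGrowth κ δ n (J s))
      (-J s - 1 / (2 * (κ + |J s| ^ δ / n)) * fisherInfoDeriv K m (u s)) s := fun s hs =>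
    (hu.hasDerivAt_relEntropy h ha hab hs).sub
      ((hasDerivAt_entropyGrowth hκ hδ hn (J s)).comp s (hJd s hs))
  -- `entropyGrowth` is designed so that its derivative at J times 2(κJ + J^{1+δ}/n) is exactly J,
  -- the dissipation rate of the entropy.
  have hmono : MonotoneOn (fun s => relEntropy m (u s) - entropyGrowth κ δ n (J s)) (Ioi 0) := by
    refine monotoneOn_of_deriv_nonneg (convex_Ioi 0)
      (fun s hs => (hG s hs).continuousAt.continuousWithinAt) ?_ ?_ <;> rw [interior_Ioi]
    · exact fun s hs => (hG s hs).differentiableAt.differentiableWithinAt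
    · intro s hs
      have hp := entropyGrowth_denom_pos (δ := δ) hκ hn (J s)
      have e := mul_le_mul_of_nonneg_left (hle s hs) (one_div_pos.2 hp).le
      have e2 : 1 / (2 * (κ + |J s| ^ δ / n)) * (-2 * (κ * J s + J s ^ (1 + δ) / n)) = -J s := by
        rw [Real.rpow_add_of_nonneg (hJ0 s hs) zero_le_one hδ.le, Real.rpow_one,
          show -2 * (κ * J s + J s * J s ^ δ / n) = 2 * (κ + J s ^ δ / n) * -J s by ring,
          abs_of_nonneg (hJ0 s hs), ← mul_assoc, one_div_mul_cancel, one_mul]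
        rw [abs_of_nonneg (hJ0 s hs)] at hp
        exact hp.ne'
      rw [(hG s hs).deriv]
      linarith
  have hE := hu.tendsto_relEntropy h ha hab h1 hirr hlim
  -- For s ≥ t the difference is at most its value at s, hence at most the entropy at s, which tends
  -- to 0.
  have hEle : relEntropy m (u t) - entropyGrowth κ δ n (J t) ≤ 0 := by
    refine ge_of_tendsto hE ?_
    filter_upwards [eventually_ge_atTop t] with s hs
    have := hmono ht (ht.trans_le hs) hs
    have h0 := monotone_entropyGrowth hκ hδ hn (hJ0 s (ht.trans_le hs))
    rw [entropyGrowth_zero] at h0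
    simp only at this
    linarith
  linarith [monotone_entropyGrowth hκ hδ hn (hbound t ht)]

/-- The entropy inequality `∑ m f u ≤ ∑ m u log u + log ∑ m e^f` for probability densities `u`. -/
theorem sum_mul_le_relEntropy_add_log {u f : X → ℝ} {a M : ℝ} (hm : ∀ x, 0 ≤ m x)
    (hm1 : HasSum m 1) (ha : 0 < a) (hu : ∀ x, u x ∈ Icc a M) (h1 : HasSum (fun x => m x * u x) 1)
    (hf : IsBoundedFun f) (hf0 : 0 < ∑' x, m x * Real.exp (f x)) :
    ∑' x, m x * (u x * f x) ≤ relEntropy m u + Real.log (∑' x, m x * Real.exp (f x)) := by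
  obtain ⟨C, hC0, hC⟩ := hf.exists_nonneg
  have hM : ∀ x, |u x| ≤ M := fun x => by
    rw [abs_of_pos (ha.trans_le (hu x).1)]; exact (hu x).2
  set Z := ∑' x, m x * Real.exp (f x) with hZ
  have s1 : Summable fun x => m x * (u x * f x) :=
    Summable.of_norm_bounded (hm1.summable.mul_right (M * C)) fun x => by
      rw [norm_mul, Real.norm_of_nonneg (hm x), norm_mul]
      exact mul_le_mul_of_nonneg_left (mul_le_mul (hM x) (hC x) (norm_nonneg _)
        ((abs_nonneg _).trans (hM x))) (hm x)
  have s2 : Summable fun x => m x * (u x * Real.log (u x)) :=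
    Summable.of_norm_bounded (hm1.summable.mul_right (M * (|Real.log a| + |Real.log M|)))
      fun x => by
      rw [norm_mul, Real.norm_of_nonneg (hm x), norm_mul]
      exact mul_le_mul_of_nonneg_left (mul_le_mul (hM x) (abs_log_le ha (hu x).1 (hu x).2)
        (norm_nonneg _) ((abs_nonneg _).trans (hM x))) (hm x)
  have s3 : Summable fun x => m x * Real.exp (f x) :=
    Summable.of_norm_bounded (hm1.summable.mul_right (Real.exp C)) fun x => by
      rw [norm_mul, Real.norm_of_nonneg (hm x), Real.norm_of_nonneg (Real.exp_pos _).le]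
      exact mul_le_mul_of_nonneg_left (Real.exp_le_exp.2 (abs_le.1 (hC x)).2) (hm x)
  have key := hasSum_le (fun x => ?_) s1.hasSum
    (((s2.hasSum.add (s3.hasSum.div_const Z)).sub h1).add (h1.mul_right (Real.log Z)))
  · rw [← hZ, div_self hf0.ne'] at key
    unfold relEntropy
    linarith
  · have hx : 0 < u x := ha.trans_le (hu x).1
    -- Multiplied by u(x), this is the pointwise Young inequality u f ≤ u log u + e^f/Z - u + u log
    -- Z; in the sum, e^f/Z and u each have mass 1 and cancel.
    have e := Real.add_one_le_exp (f x - Real.log Z - Real.log (u x))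
    rw [Real.exp_sub, Real.exp_sub, Real.exp_log hf0, Real.exp_log hx, le_div_iff₀ hx] at e
    have := mul_le_mul_of_nonneg_left e (hm x)
    have e2 : m x * (Real.exp (f x) / Z) = m x * Real.exp (f x) / Z := by ring
    linarith

end

/-! ### Transition probabilities of the minimal chain -/

noncomputable section

open Filter Topology

/-- The off-diagonal part of a rate matrix. -/
def offDiag {X : Type*} (k : X → X → ℝ) (x : X) : X → ℝ := indicator {x}ᶜ (k x)

section Rates

variable {X : Type*} {k : X → X → ℝ}

theorem offDiag_of_ne {x y : X} (hxy : x ≠ y) : offDiag k x y = k x y :=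
  indicator_of_mem (by simpa using hxy.symm) _

theorem offDiag_self (x : X) : offDiag k x x = 0 :=
  indicator_of_notMem (by simp) _

theorem IsRateMatrix.offDiag_nonneg (hk : IsRateMatrix k) (x y : X) : 0 ≤ offDiag k x y := by
  rcases eq_or_ne x y with rfl | h
  · rw [offDiag_self]
  · rw [offDiag_of_ne h]; exact hk.nonneg x y h

theorem IsRateMatrix.rate_nonneg (hk : IsRateMatrix k) (x : X) : 0 ≤ rate (offDiag k) x :=
  tsum_nonneg (hk.offDiag_nonneg x)

theorem IsRateMatrix.summable_offDiag (hk : IsRateMatrix k) (x : X) : Summable (offDiag k x) :=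
  (hk.hasSum_zero x).summable.indicator _

theorem tsum_ne_eq {M : Type*} [AddCommMonoid M] [TopologicalSpace M] (x : X) (f : X → M) :
    ∑' y : {y : X // y ≠ x}, f y = ∑' y, indicator {x}ᶜ f y :=
  tsum_subtype ({x}ᶜ : Set X) f

theorem rate_offDiag (x : X) : rate (offDiag k) x = M₁ k x :=
  (tsum_ne_eq x (k x)).symm

theorem tsum_ofReal_mul (x : X) (T : X → ℝ≥0∞) :
    ∑' z : {z : X // z ≠ x}, ENNReal.ofReal (k x z) * T z =
      ∑' z, ENNReal.ofReal (offDiag k x z) * T z := by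
  rw [tsum_ne_eq x fun z => ENNReal.ofReal (k x z) * T z]
  refine tsum_congr fun z => ?_
  rcases eq_or_ne x z with rfl | h
  · simp [offDiag_self]
  · rw [offDiag_of_ne h, indicator_of_mem (by simpa using h.symm)]

/-- Diagonal rates always multiply H(0) = 0, so the negative entries k(x,x) can be replaced by 0 and
all rates taken nonnegative. -/
theorem tsum_offDiag_mul {H : ℝ → ℝ} (hH : H 0 = 0) (f : X → ℝ) (x : X) :
    Psi (offDiag k) H f x = Psi k H f x := by
  refine tsum_congr fun y => ?_
  rcases eq_or_ne x y with rfl | h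
  · simp [hH]
  · rw [offDiag_of_ne h]

theorem generator_offDiag (f : X → ℝ) : generator (offDiag k) f = generator k f :=
  funext fun x => tsum_offDiag_mul (H := id) rfl f x

theorem B_offDiag (H : ℝ → ℝ) (f g : X → ℝ) (x : X) : B (offDiag k) H f g x = B k H f g x := by
  refine tsum_congr fun y => ?_
  rcases eq_or_ne x y with rfl | h
  · simp
  · rw [offDiag_of_ne h]

theorem cdUpsilon_offDiag {κ : ℝ} {F : ℝ → ℝ} (h : CDUpsilon k κ F) :
    CDUpsilon (offDiag k) κ F := by
  have e : ∀ f : X → ℝ, Psi (offDiag k) Upsilon f = Psi k Upsilon f := fun f =>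
    funext fun x => tsum_offDiag_mul (by simp [Upsilon]) f x
  intro x f hf
  have := h x f hf
  rwa [Psi₂, e, generator_offDiag, generator_offDiag, B_offDiag]

theorem tsum_iSup_of_monotone {f : X → ℕ → ℝ≥0∞} (hf : ∀ x, Monotone (f x)) :
    ∑' x, ⨆ n, f x n = ⨆ n, ∑' x, f x n := by
  simp only [ENNReal.tsum_eq_iSup_sum]
  rw [iSup_comm]
  exact iSup_congr fun s => ENNReal.finsetSum_iSup_of_monotone hf

theorem measurable_lintegral_Ioc {H : ℝ → ℝ → ℝ≥0∞} (hH : Measurable (Function.uncurry H)) :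
    Measurable fun t => ∫⁻ s in Ioc 0 t, H t s := by
  have hs : MeasurableSet {p : ℝ × ℝ | p.2 ∈ Ioc 0 p.1} :=
    (measurableSet_lt measurable_const measurable_snd).inter
      (measurableSet_le measurable_snd measurable_fst)
  have := (hH.indicator hs).lintegral_prod_right' (ν := volume)
  refine (funext fun t => ?_ : (fun t => ∫⁻ s in Ioc 0 t, H t s) = _) ▸ this
  rw [← lintegral_indicator measurableSet_Ioc]
  rfl

/-- One step of the recursion for the transition probabilities. -/
def jumpStep (k : X → X → ℝ) (p : ℝ → X → X → ℝ≥0∞) (t : ℝ) (x y : X) : ℝ≥0∞ :=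
  indicator {x} (fun _ => ENNReal.ofReal (Real.exp (-(M₁ k x * t)))) y +
    ∫⁻ s in Ioc 0 t, ENNReal.ofReal (Real.exp (-(M₁ k x * s))) *
      ∑' z, ENNReal.ofReal (offDiag k x z) * p (t - s) z y

theorem transProbJumps_succ (n : ℕ) (t : ℝ) (x y : X) :
    transProbJumps k (n + 1) t x y = jumpStep k (transProbJumps k n) t x y := by
  rw [transProbJumps, jumpStep]
  congr 1
  refine lintegral_congr fun s => ?_
  rw [tsum_ofReal_mul x fun z => transProbJumps k n (t - s) z y]

theorem jumpStep_mono {p p' : ℝ → X → X → ℝ≥0∞} (h : ∀ t x y, p t x y ≤ p' t x y) (t : ℝ)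
    (x y : X) : jumpStep k p t x y ≤ jumpStep k p' t x y := by
  unfold jumpStep
  gcongr
  exact h _ _ _

theorem transProbJumps_mono (t : ℝ) (x y : X) : Monotone fun n => transProbJumps k n t x y := by
  refine monotone_nat_of_le_succ fun n => ?_
  induction n generalizing t x y with
  | zero => rw [transProbJumps_succ, transProbJumps]; exact le_self_add
  | succ n ih =>
    rw [transProbJumps_succ, transProbJumps_succ]
    exact jumpStep_mono ih t x y

end Rates

section TransProb

variable {X : Type*} [Countable X] {k : X → X → ℝ}

theorem measurable_exp_rate (c : ℝ) :
    Measurable fun t : ℝ => ENNReal.ofReal (Real.exp (-(c * t))) := by fun_prop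

theorem measurable_jump_integrand {p : ℝ → X → ℝ≥0∞} (hp : ∀ z, Measurable fun t => p t z)
    (x : X) : Measurable (Function.uncurry fun t s : ℝ =>
      ENNReal.ofReal (Real.exp (-(M₁ k x * s))) *
        ∑' z, ENNReal.ofReal (offDiag k x z) * p (t - s) z) := by
  refine ((measurable_exp_rate _).comp measurable_snd).mul (Measurable.tsum fun z => ?_)
  exact ((hp z).comp (measurable_fst.sub measurable_snd)).const_mul _

theorem measurable_jumpStep {p : ℝ → X → X → ℝ≥0∞} (hp : ∀ z y, Measurable fun t => p t z y)
    (x y : X) : Measurable fun t => jumpStep k p t x y := by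
  refine Measurable.add ?_ (measurable_lintegral_Ioc
    (measurable_jump_integrand (fun z => hp z y) x))
  by_cases h : y ∈ ({x} : Set X)
  · simpa only [indicator_of_mem h] using measurable_exp_rate _
  · simp only [indicator_of_notMem h, measurable_const]

theorem measurable_transProbJumps (n : ℕ) (x y : X) :
    Measurable fun t => transProbJumps k n t x y := by
  induction n generalizing x y with
  | zero =>
    by_cases h : y ∈ ({x} : Set X)
    · simpa only [transProbJumps, indicator_of_mem h] using measurable_exp_rate _
    · simp only [transProbJumps, indicator_of_notMem h, measurable_const]
  | succ n ih =>
    simp only [transProbJumps_succ]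
    exact measurable_jumpStep ih x y

theorem measurable_transProb (x y : X) : Measurable fun t => transProb k t x y :=
  Measurable.iSup fun n => measurable_transProbJumps n x y

/-- The backward integral equation. -/
theorem transProb_eq (t : ℝ) (x y : X) : transProb k t x y = jumpStep k (transProb k) t x y := by
  have h1 : transProb k t x y = ⨆ n, transProbJumps k (n + 1) t x y :=
    ((transProbJumps_mono t x y).iSup_nat_add 1).symm
  rw [h1]
  simp only [transProbJumps_succ, jumpStep]
  -- Monotone convergence in the number of jumps, for the time integral here and for the sum over z
  -- below.
  rw [← ENNReal.add_iSup, ← lintegral_iSup]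
  · congr 1
    refine lintegral_congr fun s => ?_
    rw [← ENNReal.mul_iSup, ← tsum_iSup_of_monotone]
    · simp only [← ENNReal.mul_iSup]
      rfl
    · exact fun z n n' hn => mul_le_mul_right (transProbJumps_mono _ _ _ hn) _
  · exact fun n => (measurable_jump_integrand (fun z => measurable_transProbJumps n z y) x).comp
      measurable_prodMk_left
  · intro n n' hn s
    simp only
    gcongr
    exact transProbJumps_mono _ _ _ hn

theorem tsum_jumpStep_mul {p : ℝ → X → X → ℝ≥0∞} (hp : ∀ z y, Measurable fun t => p t z y)
    (F : X → ℝ≥0∞) (t : ℝ) (x : X) :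
    ∑' y, jumpStep k p t x y * F y =
      ENNReal.ofReal (Real.exp (-(M₁ k x * t))) * F x +
        ∫⁻ s in Ioc 0 t, ENNReal.ofReal (Real.exp (-(M₁ k x * s))) *
          ∑' z, ENNReal.ofReal (offDiag k x z) * ∑' y, p (t - s) z y * F y := by
  simp only [jumpStep, add_mul]
  rw [ENNReal.tsum_add]
  congr 1
  · rw [tsum_eq_single x fun y hy => by rw [indicator_of_notMem (by simpa using hy), zero_mul],
      indicator_of_mem (mem_singleton x)]
  · have hm : ∀ y, Measurable fun s => ENNReal.ofReal (Real.exp (-(M₁ k x * s))) *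
        ∑' z, ENNReal.ofReal (offDiag k x z) * p (t - s) z y := fun y =>
      (measurable_jump_integrand (fun z => hp z y) x).comp measurable_prodMk_left
    simp only [← lintegral_mul_const _ (hm _)]
    rw [← lintegral_tsum fun y => ((hm y).mul_const _).aemeasurable]
    refine lintegral_congr fun s => ?_
    simp only [mul_assoc, ENNReal.tsum_mul_left]
    congr 1
    simp only [← ENNReal.tsum_mul_right, ← ENNReal.tsum_mul_left]
    rw [ENNReal.tsum_comm]
    simp only [mul_assoc]

theorem lintegral_exp_rate {q t : ℝ} (hq : 0 ≤ q) (ht : 0 ≤ t) :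
    ∫⁻ s in Ioc 0 t, ENNReal.ofReal (Real.exp (-(q * s))) * ENNReal.ofReal q =
      ENNReal.ofReal (1 - Real.exp (-(q * t))) := by
  have hd : ∀ s ∈ uIcc 0 t, HasDerivAt (fun s => -Real.exp (-(q * s)))
      (Real.exp (-(q * s)) * q) s := fun s _ => by
    have := (((hasDerivAt_id s).const_mul q).neg.exp).neg
    refine this.congr_deriv ?_
    simp
  have hc : Continuous fun s => Real.exp (-(q * s)) * q := by fun_prop
  have := intervalIntegral.integral_eq_sub_of_hasDerivAt hd (hc.intervalIntegrable _ _)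
  rw [intervalIntegral.integral_of_le ht] at this
  simp only [← ENNReal.ofReal_mul (Real.exp_pos _).le]
  rw [← ofReal_integral_eq_lintegral_ofReal hc.integrableOn_Ioc
    (ae_of_all _ fun s => by positivity), this]
  congr 1
  simp
  ring

/-- Induction on the number of jumps: with q = M₁(x), the mass is at most e^{-qt} + ∫₀^t q e^{-qs}
ds = 1. Equality has to wait for `semigroup_one`. -/
theorem tsum_transProb_le (hk : IsRateMatrix k) {t : ℝ} (ht : 0 ≤ t) (x : X) :
    ∑' y, transProb k t x y ≤ 1 := by
  simp only [transProb]
  rw [tsum_iSup_of_monotone fun y => transProbJumps_mono t x y]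
  refine iSup_le fun n => ?_
  induction n generalizing t x with
  | zero =>
    have hq : 0 ≤ M₁ k x := rate_offDiag (k := k) x ▸ hk.rate_nonneg x
    have he : Real.exp (-(M₁ k x * t)) ≤ 1 := Real.exp_le_one_iff.2 (by nlinarith)
    simp only [transProbJumps]
    rw [tsum_eq_single x fun y hy => indicator_of_notMem (by simpa using hy) _,
      indicator_of_mem (mem_singleton x)]
    exact ENNReal.ofReal_le_one.2 he
  | succ n ih =>
    have hq : 0 ≤ M₁ k x := rate_offDiag (k := k) x ▸ hk.rate_nonneg x
    have he : Real.exp (-(M₁ k x * t)) ≤ 1 := Real.exp_le_one_iff.2 (by nlinarith)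
    have e := tsum_jumpStep_mul (k := k) (measurable_transProbJumps (k := k) n) (fun _ => 1) t x
    simp only [mul_one] at e
    simp only [transProbJumps_succ]
    rw [e]
    calc _ ≤ ENNReal.ofReal (Real.exp (-(M₁ k x * t))) +
          ∫⁻ s in Ioc 0 t, ENNReal.ofReal (Real.exp (-(M₁ k x * s))) *
            ENNReal.ofReal (M₁ k x) := by
          gcongr ?_ + ?_
          · exact le_rfl
          refine setLIntegral_mono' measurableSet_Ioc fun s hs => ?_
          gcongr
          rw [← rate_offDiag, rate, ENNReal.ofReal_tsum_of_nonneg (hk.offDiag_nonneg x)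
            (hk.summable_offDiag x)]
          refine ENNReal.tsum_le_tsum fun z => ?_
          exact mul_le_of_le_one_right' (ih (sub_nonneg.2 hs.2) z)
      _ = 1 := by
          rw [lintegral_exp_rate hq ht, ← ENNReal.ofReal_add (Real.exp_pos _).le (by linarith)]
          simp

end TransProb

end

/-! ### The semigroup solves the backward equation -/

noncomputable section

open Filter Topology

theorem generator_offDiag_eq {X : Type*} {k : X → X → ℝ} (hk : IsRateMatrix k)
    {g : X → ℝ} (hg : IsBoundedFun g) (x : X) :
    generator (offDiag k) g x = (∑' z, offDiag k x z * g z) - M₁ k x * g x := by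
  obtain ⟨C, h0, hC⟩ := hg.exists_nonneg
  have hs : Summable fun z => offDiag k x z * g z :=
    Summable.of_norm_bounded ((hk.summable_offDiag x).mul_right C) fun z => by
      rw [norm_mul, Real.norm_of_nonneg (hk.offDiag_nonneg x z)]
      exact mul_le_mul_of_nonneg_left (hC z) (hk.offDiag_nonneg x z)
  rw [generator, ← rate_offDiag, rate, ← tsum_mul_right,
    ← hs.tsum_sub ((hk.summable_offDiag x).mul_right _)]
  exact tsum_congr fun z => by ring

section SemigroupFlow

variable {X : Type*} [Countable X] {k : X → X → ℝ}

/-- The semigroup acting on `[0,∞]`-valued functions. -/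
def semigroupENN {X : Type*} (k : X → X → ℝ) (F : X → ℝ≥0∞) (t : ℝ) (x : X) : ℝ≥0∞ :=
  ∑' y, transProb k t x y * F y

theorem measurable_semigroupENN (F : X → ℝ≥0∞) (x : X) :
    Measurable fun t => semigroupENN k F t x :=
  Measurable.tsum fun y => (measurable_transProb x y).mul_const _

theorem semigroupENN_eq (F : X → ℝ≥0∞) (t : ℝ) (x : X) :
    semigroupENN k F t x = ENNReal.ofReal (Real.exp (-(M₁ k x * t))) * F x +
      ∫⁻ s in Ioc 0 t, ENNReal.ofReal (Real.exp (-(M₁ k x * s))) *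
        ∑' z, ENNReal.ofReal (offDiag k x z) * semigroupENN k F (t - s) z := by
  have := tsum_jumpStep_mul (k := k) (p := transProb k) (fun z y => measurable_transProb z y) F t x
  simp only [← transProb_eq] at this
  exact this

theorem semigroupENN_le (hk : IsRateMatrix k) {F : X → ℝ≥0∞} {C : ℝ≥0∞} (hF : ∀ x, F x ≤ C)
    {t : ℝ} (ht : 0 ≤ t) (x : X) : semigroupENN k F t x ≤ C :=
  calc _ ≤ ∑' y, transProb k t x y * C := ENNReal.tsum_le_tsum fun y => by gcongr; exact hF y
    _ ≤ C := by
      rw [ENNReal.tsum_mul_right]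
      exact mul_le_of_le_one_left' (tsum_transProb_le hk ht x)

theorem transProb_ne_top (hk : IsRateMatrix k) {t : ℝ} (ht : 0 ≤ t) (x y : X) :
    transProb k t x y ≠ ∞ :=
  ((ENNReal.le_tsum y).trans (tsum_transProb_le hk ht x)).trans_lt ENNReal.one_lt_top |>.ne

theorem semigroup_eq_toReal (hk : IsRateMatrix k) {f : X → ℝ} (hf : ∀ x, 0 ≤ f x)
    {t : ℝ} (ht : 0 ≤ t) (x : X) :
    semigroup k t f x = (semigroupENN k (fun y => ENNReal.ofReal (f y)) t x).toReal := by
  rw [semigroupENN, ENNReal.tsum_toReal_eq fun y =>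
    ENNReal.mul_ne_top (transProb_ne_top hk ht x y) ENNReal.ofReal_ne_top]
  exact tsum_congr fun y => by rw [ENNReal.toReal_mul, ENNReal.toReal_ofReal (hf y)]

theorem summable_transProb (hk : IsRateMatrix k) {t : ℝ} (ht : 0 ≤ t) (x : X) :
    Summable fun y => (transProb k t x y).toReal :=
  ENNReal.summable_toReal (ne_top_of_le_ne_top ENNReal.one_ne_top (tsum_transProb_le hk ht x))

theorem summable_semigroup (hk : IsRateMatrix k) {f : X → ℝ} (hf : IsBoundedFun f)
    {t : ℝ} (ht : 0 ≤ t) (x : X) : Summable fun y => (transProb k t x y).toReal * f y := by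
  obtain ⟨C, h0, hC⟩ := hf.exists_nonneg
  refine Summable.of_norm_bounded ((summable_transProb hk ht x).mul_right C) fun y => ?_
  rw [norm_mul, Real.norm_of_nonneg ENNReal.toReal_nonneg]
  exact mul_le_mul_of_nonneg_left (hC y) ENNReal.toReal_nonneg

theorem semigroup_abs_le (hk : IsRateMatrix k) {f : X → ℝ} {C : ℝ} (h0 : 0 ≤ C)
    (hC : ∀ x, |f x| ≤ C) {t : ℝ} (ht : 0 ≤ t) (x : X) : |semigroup k t f x| ≤ C := by
  have h1 : ∑' y, (transProb k t x y).toReal ≤ 1 := by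
    rw [← ENNReal.tsum_toReal_eq (transProb_ne_top hk ht x), ← ENNReal.toReal_one]
    exact ENNReal.toReal_mono ENNReal.one_ne_top (tsum_transProb_le hk ht x)
  have hs := (summable_transProb hk ht x).mul_right C
  calc ‖semigroup k t f x‖ ≤ ∑' y, (transProb k t x y).toReal * C :=
        tsum_of_norm_bounded hs.hasSum fun y => by
          rw [norm_mul, Real.norm_of_nonneg ENNReal.toReal_nonneg]
          exact mul_le_mul_of_nonneg_left (hC y) ENNReal.toReal_nonneg
    _ ≤ C := by
      rw [tsum_mul_right]
      exact mul_le_of_le_one_left h0 h1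

theorem transProb_zero (x y : X) : transProb k 0 x y = indicator {x} (fun _ => 1) y := by
  rw [transProb_eq, jumpStep]
  simp

theorem semigroup_zero (f : X → ℝ) (x : X) : semigroup k 0 f x = f x := by
  rw [semigroup, tsum_eq_single x]
  · simp [transProb_zero]
  · intro y hy
    rw [transProb_zero, indicator_of_notMem (by simpa using hy)]
    simp

theorem semigroup_sub_const (hk : IsRateMatrix k) {f : X → ℝ} (hf : IsBoundedFun f) (c : ℝ)
    {t : ℝ} (ht : 0 ≤ t) (x : X) :
    semigroup k t (fun y => f y - c) x = semigroup k t f x - c * semigroup k t (fun _ => 1) x := by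
  have h1 := summable_semigroup hk (f := fun _ => 1) ⟨1, fun _ => by simp⟩ ht x
  rw [semigroup, semigroup, semigroup, ← tsum_mul_left,
    ← (summable_semigroup hk hf ht x).tsum_sub (h1.mul_left c)]
  exact tsum_congr fun y => by ring

/-- The incoming mass in the backward equation, continued to negative times. -/
def jumpSource {X : Type*} (k : X → X → ℝ) (f : X → ℝ) (x : X) (t : ℝ) : ℝ :=
  ∑' z, offDiag k x z * semigroup k (max t 0) f z

theorem jumpSource_eq_toReal (hk : IsRateMatrix k) {f : X → ℝ} (hf : ∀ x, 0 ≤ f x)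
    (hb : IsBoundedFun f) (x : X) (t : ℝ) :
    jumpSource k f x t = (∑' z, ENNReal.ofReal (offDiag k x z) *
      semigroupENN k (fun y => ENNReal.ofReal (f y)) (max t 0) z).toReal := by
  obtain ⟨C, h0, hC⟩ := hb.exists_nonneg
  have ht : 0 ≤ max t 0 := le_max_right _ _
  rw [ENNReal.tsum_toReal_eq]
  · refine tsum_congr fun z => ?_
    rw [ENNReal.toReal_mul, ENNReal.toReal_ofReal (hk.offDiag_nonneg x z),
      semigroup_eq_toReal hk hf ht]
  · exact fun z => ENNReal.mul_ne_top ENNReal.ofReal_ne_top (ne_top_of_le_ne_top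
      (ENNReal.ofReal_ne_top (r := C)) (semigroupENN_le hk
        (fun y => ENNReal.ofReal_le_ofReal ((le_abs_self _).trans (hC y))) ht z))

theorem jumpSource_abs_le (hk : IsRateMatrix k) {f : X → ℝ} {C : ℝ} (h0 : 0 ≤ C)
    (hC : ∀ x, |f x| ≤ C) (x : X) (t : ℝ) : |jumpSource k f x t| ≤ rate (offDiag k) x * C := by
  rw [rate, ← tsum_mul_right, ← Real.norm_eq_abs]
  refine tsum_of_norm_bounded ((hk.summable_offDiag x).mul_right C).hasSum fun z => ?_
  rw [norm_mul, Real.norm_of_nonneg (hk.offDiag_nonneg x z)]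
  exact mul_le_mul_of_nonneg_left (semigroup_abs_le hk h0 hC (le_max_right _ _) z)
    (hk.offDiag_nonneg x z)

theorem measurable_jumpSource (hk : IsRateMatrix k) {f : X → ℝ} (hf : ∀ x, 0 ≤ f x)
    (hb : IsBoundedFun f) (x : X) : Measurable (jumpSource k f x) := by
  rw [funext (jumpSource_eq_toReal hk hf hb x)]
  exact (Measurable.tsum fun z => ((measurable_semigroupENN _ z).comp
    (measurable_id.max measurable_const)).const_mul _).ennreal_toReal

theorem intervalIntegrable_jumpSource (hk : IsRateMatrix k) {f : X → ℝ} (hf : ∀ x, 0 ≤ f x)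
    (hb : IsBoundedFun f) (x : X) (a b : ℝ) :
    IntervalIntegrable (fun s => Real.exp (M₁ k x * s) * jumpSource k f x s) volume a b := by
  obtain ⟨C, h0, hC⟩ := hb.exists_nonneg
  have h1 : IntervalIntegrable (jumpSource k f x) volume a b :=
    (intervalIntegrable_const (c := rate (offDiag k) x * C)).mono_fun'
      (measurable_jumpSource hk hf hb x).aestronglyMeasurable
      (ae_of_all _ fun s => jumpSource_abs_le hk h0 hC x s)
  exact h1.continuousOn_mul (Continuous.continuousOn (by fun_prop))

/-- Reversing time, s ↦ t - s, takes t out of the integrand, so t remains only in the exponential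
factor and in the upper limit. -/
theorem semigroup_integral_eq (hk : IsRateMatrix k) {f : X → ℝ} (hf : ∀ x, 0 ≤ f x)
    (hb : IsBoundedFun f) (x : X) {t : ℝ} (ht : 0 ≤ t) :
    semigroup k t f x = Real.exp (-(M₁ k x * t)) *
      (f x + ∫ s in (0 : ℝ)..t, Real.exp (M₁ k x * s) * jumpSource k f x s) := by
  obtain ⟨C, h0, hC⟩ := hb.exists_nonneg
  set F : X → ℝ≥0∞ := fun y => ENNReal.ofReal (f y) with hF
  have hFC : ∀ y, F y ≤ ENNReal.ofReal C := fun y =>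
    ENNReal.ofReal_le_ofReal ((le_abs_self _).trans (hC y))
  have hfin : semigroupENN k F t x ≠ ∞ :=
    ne_top_of_le_ne_top ENNReal.ofReal_ne_top (semigroupENN_le hk hFC ht x)
  have e := semigroupENN_eq (k := k) F t x
  rw [e, ENNReal.add_ne_top] at hfin
  rw [semigroup_eq_toReal hk hf ht, e, ENNReal.toReal_add hfin.1 hfin.2, ENNReal.toReal_mul,
    ENNReal.toReal_ofReal (Real.exp_pos _).le, ENNReal.toReal_ofReal (hf x), mul_add]
  congr 1
  have hm := ((measurable_jump_integrand (k := k)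
    (fun z => measurable_semigroupENN (k := k) F z) x).comp
    (measurable_prodMk_left (x := t))).aemeasurable (μ := volume.restrict (Ioc 0 t))
  have hi := integral_toReal hm (ae_lt_top' hm hfin.2)
  simp only [Function.comp_def, Function.uncurry] at hi
  rw [← hi, ← intervalIntegral.integral_of_le ht, ← intervalIntegral.integral_const_mul]
  have hsub := intervalIntegral.integral_comp_sub_left (a := 0) (b := t)
    (fun s => Real.exp (-(M₁ k x * t)) * (Real.exp (M₁ k x * s) * jumpSource k f x s)) t
  rw [sub_self, sub_zero] at hsub
  rw [← hsub]
  refine intervalIntegral.integral_congr fun s hs => ?_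
  rw [uIcc_of_le ht] at hs
  rw [jumpSource_eq_toReal hk hf hb, max_eq_left (sub_nonneg.2 hs.2), ENNReal.toReal_mul,
    ENNReal.toReal_ofReal (Real.exp_pos _).le, ← mul_assoc, ← Real.exp_add]
  congr 2
  ring

/-- A bootstrap: a bounded measurable source makes the semigroup continuous in time; then the source
is continuous, and the integral formula can be differentiated. -/
theorem continuous_semigroup_max (hk : IsRateMatrix k) {f : X → ℝ} (hf : ∀ x, 0 ≤ f x)
    (hb : IsBoundedFun f) (x : X) : Continuous fun t => semigroup k (max t 0) f x := by
  rw [funext fun t => semigroup_integral_eq hk hf hb x (le_max_right t 0)]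
  have := (intervalIntegral.continuous_primitive (intervalIntegrable_jumpSource hk hf hb x) 0).comp
    (continuous_id.max continuous_const : Continuous fun t : ℝ => max t 0)
  exact (by fun_prop : Continuous fun t : ℝ => Real.exp (-(M₁ k x * max t 0))).mul
    (continuous_const.add this)

theorem continuous_jumpSource (hk : IsRateMatrix k) {f : X → ℝ} (hf : ∀ x, 0 ≤ f x)
    (hb : IsBoundedFun f) (x : X) : Continuous (jumpSource k f x) := by
  obtain ⟨C, h0, hC⟩ := hb.exists_nonneg
  refine continuous_tsum (fun z => continuous_const.mul (continuous_semigroup_max hk hf hb z))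
    ((hk.summable_offDiag x).mul_right C) fun z t => ?_
  rw [norm_mul, Real.norm_of_nonneg (hk.offDiag_nonneg x z)]
  exact mul_le_mul_of_nonneg_left (semigroup_abs_le hk h0 hC (le_max_right _ _) z)
    (hk.offDiag_nonneg x z)

theorem isHeatFlow_semigroup_of_nonneg (hk : IsRateMatrix k) {f : X → ℝ} (hf : ∀ x, 0 ≤ f x)
    (hb : IsBoundedFun f) : IsHeatFlow (offDiag k) fun t => semigroup k t f := by
  obtain ⟨C, h0, hC⟩ := hb.exists_nonneg
  refine ⟨⟨C, h0, fun t ht x => semigroup_abs_le hk h0 hC ht x⟩, fun x => ?_, fun x t ht => ?_⟩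
  · exact (continuous_semigroup_max hk hf hb x).continuousOn.congr fun t ht => by
      simp only; rw [max_eq_left ht]
  · have hG : Continuous fun s => Real.exp (M₁ k x * s) * jumpSource k f x s :=
      (by fun_prop : Continuous fun s => Real.exp (M₁ k x * s)).mul
        (continuous_jumpSource hk hf hb x)
    have d1 := ((hG.integral_hasStrictDerivAt 0 t).hasDerivAt).const_add (f x)
    have d2 : HasDerivAt (fun t => Real.exp (-(M₁ k x * t)))
        (Real.exp (-(M₁ k x * t)) * -M₁ k x) t := by
      refine ((hasDerivAt_id t).const_mul (M₁ k x)).neg.exp.congr_deriv ?_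
      simp
    have heq : (fun t => semigroup k t f x) =ᶠ[𝓝 t] fun t => Real.exp (-(M₁ k x * t)) *
        (f x + ∫ s in (0 : ℝ)..t, Real.exp (M₁ k x * s) * jumpSource k f x s) := by
      filter_upwards [lt_mem_nhds ht] with s hs using semigroup_integral_eq hk hf hb x (le_of_lt hs)
    refine ((d2.mul d1).congr_of_eventuallyEq heq).congr_deriv ?_
    rw [generator_offDiag_eq hk ⟨C, fun z => semigroup_abs_le hk h0 hC ht.le z⟩,
      semigroup_integral_eq hk hf hb x ht.le, ← mul_assoc (Real.exp (-(M₁ k x * t))), ← Real.exp_add,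
      neg_add_cancel, Real.exp_zero, one_mul, jumpSource, max_eq_left ht.le]
    ring

theorem isHeatFlow_semigroup (hk : IsRateMatrix k) {f : X → ℝ} (hb : IsBoundedFun f) :
    IsHeatFlow (offDiag k) fun t => semigroup k t f := by
  obtain ⟨C, h0, hC⟩ := hb.exists_nonneg
  have hb1 : IsBoundedFun fun y => f y + C := ⟨C + C, fun x => (abs_add_le _ _).trans
    (by linarith [hC x, abs_of_nonneg h0])⟩
  have hb2 : IsBoundedFun fun _ : X => (1 : ℝ) := ⟨1, fun _ => by simp⟩
  have h1 := isHeatFlow_semigroup_of_nonneg hk (f := fun y => f y + C)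
    (fun x => by linarith [(abs_le.1 (hC x)).1]) hb1
  have h2 := isHeatFlow_semigroup_of_nonneg hk (f := fun _ => 1) (fun _ => zero_le_one) hb2
  -- A signed f is shifted to f + C ≥ 0. The correction is C P_t 1 and not C, since conservation of
  -- mass is not yet available.
  have e : ∀ t, 0 ≤ t → ∀ x, semigroup k t f x =
      semigroup k t (fun y => f y + C) x - C * semigroup k t (fun _ => 1) x := fun t ht x => by
    rw [← semigroup_sub_const hk hb1 C ht]
    simp
  refine ⟨⟨C, h0, fun t ht x => semigroup_abs_le hk h0 hC ht x⟩, fun x => ?_, fun x t ht => ?_⟩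
  · exact ((h1.continuousOn x).sub (continuousOn_const.mul (h2.continuousOn x))).congr
      fun t ht => e t ht x
  · have heq : (fun t => semigroup k t f x) =ᶠ[𝓝 t] fun t =>
        semigroup k t (fun y => f y + C) x - C * semigroup k t (fun _ => 1) x := by
      filter_upwards [lt_mem_nhds ht] with s hs using e s (le_of_lt hs) x
    refine (((h1.hasDerivAt x t ht).sub
      ((h2.hasDerivAt x t ht).const_mul C)).congr_of_eventuallyEq heq).congr_deriv ?_
    have b1 := h1.isBoundedFun ht.le
    have b2 := h2.isBoundedFun ht.le
    obtain ⟨C1, -, hC1⟩ := IsReversible.bounded_diff b1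
    obtain ⟨C2, -, hC2⟩ := IsReversible.bounded_diff b2
    have hs : ∀ {g : X → ℝ} {D : ℝ}, (∀ x y, |g y - g x| ≤ D) →
        Summable fun z => offDiag k x z * (g z - g x) := fun hD =>
      Summable.of_norm_bounded ((hk.summable_offDiag x).mul_right _) fun z => by
        rw [norm_mul, Real.norm_of_nonneg (hk.offDiag_nonneg x z)]
        exact mul_le_mul_of_nonneg_left (hD x z) (hk.offDiag_nonneg x z)
    rw [generator, generator, generator, ← tsum_mul_left, ← (hs hC1).tsum_sub ((hs hC2).mul_left C)]
    refine tsum_congr fun z => ?_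
    rw [e t ht.le x, e t ht.le z]
    ring

end SemigroupFlow

end

/-! ### Conservation of mass and the pointwise bound by duality -/

noncomputable section

open Filter Topology

section Reversible

variable {X : Type*} {k : X → X → ℝ} {m : X → ℝ}

theorem tsum_exp_pos (h : IsReversible (offDiag k) m) {f : X → ℝ}
    (hs : Summable fun x => m x * Real.exp (f x)) (x : X) :
    0 < ∑' x, m x * Real.exp (f x) :=
  hs.tsum_pos (fun _ => mul_nonneg (h.pos _).le (Real.exp_pos _).le) x
    (mul_pos (h.pos x) (Real.exp_pos _))

theorem summable_exp (h : IsReversible (offDiag k) m) {f : X → ℝ} (hf : IsBoundedFun f) :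
    Summable fun x => m x * Real.exp (f x) := by
  obtain ⟨C, hC⟩ := hf
  refine Summable.of_norm_bounded (h.hasSum_one.summable.mul_right (Real.exp C))
    fun x => ?_
  rw [norm_mul, Real.norm_of_nonneg (h.pos _).le, Real.norm_of_nonneg (Real.exp_pos _).le]
  exact mul_le_mul_of_nonneg_left (Real.exp_le_exp.2 (abs_le.1 (hC x)).2) (h.pos _).le

variable [Countable X]

/-- P_t 1 and the constant 1 are bounded heat flows with the same initial value. Pairing each with
the flow of the indicator of x shows that they agree at x. -/
theorem semigroup_one (hk : IsRateMatrix k) (h : IsReversible (offDiag k) m)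
    {t : ℝ} (ht : 0 < t) (x : X) : semigroup k t (fun _ => 1) x = 1 := by
  have hb : IsBoundedFun (indicator {x} fun _ : X => (1 : ℝ)) :=
    ⟨1, fun y => by by_cases hy : y ∈ ({x} : Set X) <;> simp [hy]⟩
  have hg := isHeatFlow_semigroup hk hb
  have h1 := isHeatFlow_semigroup hk (f := fun _ : X => (1 : ℝ)) ⟨1, fun _ => by simp⟩
  have e1 := hg.sum_mul_symm h h1 ht
  have e2 := hg.sum_mul_symm h (isHeatFlow_const 1) ht
  simp only [semigroup_zero] at e1 e2
  rw [e1, tsum_eq_single x fun y hy => by rw [indicator_of_notMem (by simpa using hy)]; ring,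
    tsum_eq_single x fun y hy => by rw [indicator_of_notMem (by simpa using hy)]; ring,
    indicator_of_mem (mem_singleton x)] at e2
  simpa using mul_left_cancel₀ (h.pos x).ne' e2

theorem semigroup_mono (hk : IsRateMatrix k) {f g : X → ℝ} (hf : IsBoundedFun f)
    (hg : IsBoundedFun g) (hfg : ∀ x, f x ≤ g x) {t : ℝ} (ht : 0 ≤ t) (x : X) :
    semigroup k t f x ≤ semigroup k t g x :=
  (summable_semigroup hk hf ht x).tsum_le_tsum
    (fun y => mul_le_mul_of_nonneg_left (hfg y) ENNReal.toReal_nonneg)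
    (summable_semigroup hk hg ht x)

theorem semigroup_const (hk : IsRateMatrix k) (h : IsReversible (offDiag k) m)
    (c : ℝ) {t : ℝ} (ht : 0 ≤ t) (x : X) : semigroup k t (fun _ => c) x = c := by
  rcases ht.eq_or_lt with rfl | ht
  · exact semigroup_zero _ _
  · have := semigroup_one hk h ht x
    simp only [semigroup, mul_one] at this ⊢
    rw [tsum_mul_right, this, one_mul]

theorem semigroup_mem_Icc (hk : IsRateMatrix k)
    (h : IsReversible (offDiag k) m) {g : X → ℝ} {a M : ℝ}
    (hg : ∀ x, g x ∈ Icc a M) {t : ℝ} (ht : 0 ≤ t) (x : X) : semigroup k t g x ∈ Icc a M := by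
  have hb : IsBoundedFun g := ⟨max |a| |M|, fun y => abs_le_max_abs_abs (hg y).1 (hg y).2⟩
  have hc : ∀ c : ℝ, IsBoundedFun fun _ : X => c := fun c => ⟨|c|, fun _ => le_rfl⟩
  constructor
  · rw [← semigroup_const hk h a ht x]
    exact semigroup_mono hk (hc a) hb (fun y => (hg y).1) ht x
  · rw [← semigroup_const hk h M ht x]
    exact semigroup_mono hk hb (hc M) (fun y => (hg y).2) ht x

/-- The pointwise form of the ultracontractive bound. -/
theorem semigroup_le (hk : IsRateMatrix k) (hirr : IsIrreducible k)
    (h : IsReversible (offDiag k) m)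
    {κ δ n : ℝ} (hκ : 0 < κ) (hδ : 0 < δ) (hn : 0 < n)
    (hCD : CDUpsilon k κ fun r => r ^ (1 + δ) / n) {t : ℝ} (ht : 0 < t) {f : X → ℝ}
    (hf : IsBoundedFun f) (x : X) :
    semigroup k t f x ≤ entropyGrowth κ δ n ((n / (2 * δ * t)) ^ (1 / δ)) +
      Real.log (∑' x, m x * Real.exp (f x)) := by
  have hirr' : ∀ x y, Relation.ReflTransGen (fun a b => 0 < offDiag k a b) x y := fun x y =>
    Relation.ReflTransGen.mono
      (fun a b hab => by rw [offDiag_of_ne hab.1]; exact hab.2) x y (hirr x y)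
  set S := ∑' y, m y * semigroup k t f y with hS
  set A := entropyGrowth κ δ n ((n / (2 * δ * t)) ^ (1 / δ)) +
      Real.log (∑' x, m x * Real.exp (f x)) with hA
  have hmx := h.pos x
  have hw := isHeatFlow_semigroup hk hf
  have hsS : Summable fun y => m y * semigroup k t f y := by
    obtain ⟨C, h0, hC⟩ := hw.bounded
    refine Summable.of_norm_bounded (h.hasSum_one.summable.mul_right C) fun y => ?_
    rw [norm_mul, Real.norm_of_nonneg (h.pos y).le]
    exact mul_le_mul_of_nonneg_left (hC t ht.le y) (h.pos y).le
  have key : ∀ ε ∈ Ioo (0 : ℝ) 1, (1 - ε) * semigroup k t f x + ε * S ≤ A := by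
    intro ε hε
    -- The density of (1 - ε) δ_x + ε m; the added ε keeps it away from 0, as the entropy estimates
    -- require.
    set g : X → ℝ := fun y => indicator {x} (fun _ => (1 - ε) / m x) y + ε with hg
    have hq : 0 ≤ (1 - ε) / m x := div_nonneg (by linarith [hε.2]) hmx.le
    have hgI : ∀ y, g y ∈ Icc ε ((1 - ε) / m x + ε) := fun y =>
      ⟨le_add_of_nonneg_left (indicator_nonneg (fun _ _ => hq) y),
        by simpa [hg] using indicator_le_self' (fun _ _ => hq) y⟩
    have hgb := isBoundedFun_of_mem hε.1 hgI
    have hu := isHeatFlow_semigroup hk hgb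
    have hsum : ∀ {v : X → ℝ}, Summable (fun y => m y * v y) →
        HasSum (fun y => m y * (g y * v y))
          ((1 - ε) * v x + ε * ∑' y, m y * v y) := by
      intro v hv
      have h1 : HasSum (fun y => indicator {x} (fun y => (1 - ε) * v y) y) ((1 - ε) * v x) := by
        have := hasSum_single (f := fun y => indicator {x} (fun y => (1 - ε) * v y) y) x
          fun y hy => indicator_of_notMem (by simpa using hy) _
        rwa [indicator_of_mem (mem_singleton x)] at this
      refine (funext fun y => ?_ : (fun y => m y * (g y * v y)) = _) ▸
        h1.add (hv.hasSum.mul_left ε)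
      simp only [hg]
      by_cases hy : y ∈ ({x} : Set X)
      · rw [indicator_of_mem hy, indicator_of_mem hy]
        rw [mem_singleton_iff] at hy
        subst hy
        field_simp
      · rw [indicator_of_notMem hy, indicator_of_notMem hy]
        ring
    have hmass : ∑' y, m y * semigroup k 0 g y = 1 := by
      have := (hsum (v := fun _ => 1) (by simpa using h.hasSum_one.summable)).tsum_eq
      simp only [mul_one, h.hasSum_one.tsum_eq] at this
      simp only [semigroup_zero, this]
      ring
    have hI : ∀ s, 0 ≤ s → ∀ y, semigroup k s g y ∈ Icc ε ((1 - ε) / m x + ε) :=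
      fun s hs y => semigroup_mem_Icc hk h hgI hs y
    have hE := hu.relEntropy_le h hirr' hκ hδ hn (cdUpsilon_offDiag hCD) hε.1 hI hmass ht
    have hmt : HasSum (fun y => m y * semigroup k t g y) 1 := by
      have := hu.sum_eq h ht
      rw [← hmass, ← this]
      refine (Summable.of_norm_bounded (h.hasSum_one.summable.mul_right
        ((1 - ε) / m x + ε)) fun y => ?_).hasSum
      rw [norm_mul, Real.norm_of_nonneg (h.pos y).le,
        Real.norm_of_nonneg (hε.1.le.trans (hI t ht.le y).1)]
      exact mul_le_mul_of_nonneg_left (hI t ht.le y).2 (h.pos y).le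
    have hG := sum_mul_le_relEntropy_add_log (fun y => (h.pos y).le) h.hasSum_one hε.1
      (hI t ht.le) hmt hf (tsum_exp_pos h (summable_exp h hf) x)
    -- Symmetry moves the semigroup from the density g to f.
    have hsym := hu.sum_mul_symm h hw ht
    simp only [semigroup_zero] at hsym
    rw [hsym, (hsum hsS).tsum_eq] at hG
    linarith
  have hlim : Tendsto (fun ε : ℝ => (1 - ε) * semigroup k t f x + ε * S) (𝓝[>] 0)
      (𝓝 ((1 - 0) * semigroup k t f x + 0 * S)) :=
    ((by fun_prop : Continuous fun ε : ℝ => (1 - ε) * semigroup k t f x + ε * S).tendsto 0).mono_left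
      nhdsWithin_le_nhds
  have := le_of_tendsto hlim (by
    filter_upwards [Ioo_mem_nhdsGT one_pos] with ε hε using key ε hε)
  simpa using this

end Reversible

/-! ### From weights and pointwise bounds to the measure and its norms -/

section Measure

variable {X : Type*} [Countable X] [MeasurableSpace X] [MeasurableSingletonClass X]
  {k : X → X → ℝ} {μ : Measure X}

theorem summable_of_integrable {f : X → ℝ} (hf : Integrable f μ) :
    Summable fun x => μ.real {x} * f x := by
  have h := hf.hasFiniteIntegral
  rw [HasFiniteIntegral, lintegral_countable'] at h
  refine Summable.of_norm ((ENNReal.summable_toReal h.ne).congr fun x => ?_)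
  rw [ENNReal.toReal_mul, toReal_enorm, norm_mul, Real.norm_of_nonneg measureReal_nonneg, mul_comm]
  rfl

variable [IsProbabilityMeasure μ]

theorem hasSum_measureReal : HasSum (fun x => μ.real {x}) 1 := by
  have h : ∑' x, μ {x} = 1 := by
    simpa using (lintegral_countable' (μ := μ) fun _ => 1).symm
  have := ENNReal.hasSum_toReal (f := fun x => μ {x}) (by rw [h]; exact ENNReal.one_ne_top)
  rwa [← ENNReal.tsum_toReal_eq fun x => measure_ne_top μ _, h, ENNReal.toReal_one] at this

/-- Some point has positive mass, and detailed balance passes positivity along every jump of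
positive rate. -/
theorem measureReal_singleton_pos (hirr : IsIrreducible k) (hdb : DetailedBalance k μ) (x : X) :
    0 < μ.real {x} := by
  obtain ⟨x₀, h₀⟩ : ∃ x₀, 0 < μ.real {x₀} := by
    by_contra! hc
    have h := (hasSum_measureReal (μ := μ)).tsum_eq
    simp only [le_antisymm (hc _) measureReal_nonneg, tsum_zero] at h
    exact zero_ne_one h
  induction hirr x₀ x with
  | refl => exact h₀
  | tail _ e ih =>
    have h1 := mul_pos ih e.2
    rw [hdb] at h1
    exact measureReal_nonneg.lt_of_ne fun h => by simp [← h] at h1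

theorem isReversible_offDiag (hk : IsRateMatrix k) (hirr : IsIrreducible k)
    (hdb : DetailedBalance k μ) (hM₁ : MemLp (M₁ k) 2 μ) :
    IsReversible (offDiag k) fun x => μ.real {x} where
  nonneg := hk.offDiag_nonneg
  summable := hk.summable_offDiag
  pos := measureReal_singleton_pos hirr hdb
  hasSum_one := hasSum_measureReal
  symm x y := by
    rcases eq_or_ne x y with rfl | h
    · rfl
    · rw [offDiag_of_ne h, offDiag_of_ne h.symm]
      exact hdb x y
  summable_sq := by
    simpa only [rate_offDiag] using summable_of_integrable hM₁.integrable_sq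

theorem eLpNorm_exp_semigroup_le (hk : IsRateMatrix k) (hirr : IsIrreducible k)
    (h : IsReversible (offDiag k) fun x => μ.real {x})
    {κ δ n : ℝ} (hκ : 0 < κ) (hδ : 0 < δ) (hn : 0 < n)
    (hCD : CDUpsilon k κ fun r => r ^ (1 + δ) / n) {t : ℝ} (ht : 0 < t) {f : X → ℝ}
    (hf : IsBoundedFun f) :
    eLpNorm (fun x => Real.exp (semigroup k t f x)) ∞ μ ≤
      ENNReal.ofReal (Real.exp (entropyGrowth κ δ n ((n / (2 * δ * t)) ^ (1 / δ)))) *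
        eLpNorm (fun x => Real.exp (f x)) 1 μ := by
  have e : eLpNorm (fun x => Real.exp (f x)) 1 μ =
      ENNReal.ofReal (∑' x, μ.real {x} * Real.exp (f x)) := by
    rw [eLpNorm_one_eq_lintegral_enorm, lintegral_countable', ENNReal.ofReal_tsum_of_nonneg
      (fun x => mul_nonneg measureReal_nonneg (Real.exp_pos _).le) (summable_exp h hf)]
    refine tsum_congr fun x => ?_
    rw [ENNReal.ofReal_mul measureReal_nonneg, ofReal_measureReal,
      Real.enorm_of_nonneg (Real.exp_pos _).le, mul_comm]
  rw [e, ← ENNReal.ofReal_mul (Real.exp_pos _).le, eLpNorm_exponent_top]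
  refine eLpNormEssSup_le_of_ae_bound (ae_of_all _ fun x => ?_)
  rw [Real.norm_of_nonneg (Real.exp_pos _).le,
    ← Real.exp_log (tsum_exp_pos h (summable_exp h hf) x), ← Real.exp_add]
  exact Real.exp_le_exp.2 (semigroup_le hk hirr h hκ hδ hn hCD ht hf x)

end Measure

end

end MarkovChain

theorem mainTheorem5 {X : Type*} [Countable X] [MeasurableSpace X] [MeasurableSingletonClass X]
    (k : X → X → ℝ) (μ : Measure X) [IsProbabilityMeasure μ]
    (hk : MarkovChain.IsRateMatrix k)
    (hM₂ : MarkovChain.M₂Finite k)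
    (hirr : MarkovChain.IsIrreducible k)
    (hdb : MarkovChain.DetailedBalance k μ)
    (hM₁ℓ : MemLp (MarkovChain.M₁ k) 2 μ)
    (hM₂ℓ : MemLp (MarkovChain.M₂ k) 1 μ)
    (hrec : MarkovChain.IsPositiveRecurrent k) :
    (∀ κ δ n : ℝ, 0 < κ → 1 ≤ δ → 0 < n →
      MarkovChain.CDUpsilon k κ (fun r => r ^ (1 + δ) / n) →
      ∀ t : ℝ, 0 < t → ∀ f : X → ℝ, MarkovChain.IsBoundedFun f →
        eLpNorm (fun x => Real.exp (MarkovChain.semigroup k t f x)) ∞ μ ≤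
          ENNReal.ofReal
            (Real.exp (MarkovChain.growthFun κ δ n ((n / (2 * δ * t)) ^ (1 / δ)))) *
            eLpNorm (fun x => Real.exp (f x)) 1 μ) ∧
    (∀ κ n : ℝ, 0 < κ → 0 < n →
      MarkovChain.CDUpsilonDim k κ n →
      ∀ t : ℝ, 0 < t → ∀ f : X → ℝ, MarkovChain.IsBoundedFun f →
        eLpNorm (fun x => Real.exp (MarkovChain.semigroup k t f x)) ∞ μ ≤
          ENNReal.ofReal ((1 + 1 / (2 * κ * t)) ^ (n / 2)) *
            eLpNorm (fun x => Real.exp (f x)) 1 μ) := by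
  have h := MarkovChain.isReversible_offDiag hk hirr hdb hM₁ℓ
  refine ⟨fun κ δ n hκ hδ hn hCD t ht f hf => ?_, fun κ n hκ hn hCD t ht f hf => ?_⟩
  · have hδ0 : 0 < δ := one_pos.trans_le hδ
    rw [MarkovChain.growthFun_eq_entropyGrowth hκ hδ0 hn (by positivity)]
    exact MarkovChain.eLpNorm_exp_semigroup_le hk hirr h hκ hδ0 hn hCD ht hf
  · have hCD' : MarkovChain.CDUpsilon k κ fun r => r ^ (1 + (1 : ℝ)) / n := by
      have e : (fun r : ℝ => r ^ (1 + (1 : ℝ)) / n) = fun r => r ^ 2 / n := by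
        funext r
        rw [one_add_one_eq_two, Real.rpow_two]
      rw [e]
      exact hCD
    have key := MarkovChain.eLpNorm_exp_semigroup_le hk hirr h hκ one_pos hn hCD' ht hf
    have hb : 0 < 1 + 1 / (2 * κ * t) := by positivity
    -- For δ = 1 the integral is (n/2) log(1 + r/(κn)), evaluated at r = n/(2t).
    have e : n / (2 * 1 * t) / (κ * n) = 1 / (2 * κ * t) := by field_simp
    rw [div_one, Real.rpow_one, MarkovChain.entropyGrowth_one hκ hn (by positivity), e] at key
    rwa [Real.rpow_def_of_pos hb, mul_comm (Real.log _)]
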